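/- Let $\mathbb T=\mathbb R/2\pi\mathbb Z$, let $\langle y\rangle:=1+|y|$, and for a function or distribution $f$ on $\mathbb T\times\mathbb R$ let $\widehat f(n,\tau)=(2\pi)^{-1}\int_{\mathbb R\times\mathbb T}e^{-it\tau}e^{-ixn}f(x,t)\,dx\,dt$ $(n\in\mathbb Z,\ \tau\in\mathbb R)$ be its Fourier transform in both variables (extended to $L^2(\mathbb T\times\mathbb R)$ by Plancherel; $\widehat{\partial_x f}=in\widehat f$). For $k,s,b\in\mathbb R$ define, with values in $[0,\infty]$, $$\|f\|_{X^{k,b}}=\Big(\sum_{n\in\mathbb Z}\int_{\mathbb R}\langle n\rangle^{2k}\langle\tau+n^2\rangle^{2b}|\widehat f(n,\tau)|^2d\tau\Big)^{1/2},\qquad \|f\|_{Y^{s,b}}=\Big(\sum_{n\in\mathbb Z}\int_{\mathbb R}\langle n\rangle^{2s}\langle\tau-n^3\rangle^{2b}|\widehat f(n,\tau)|^2d\tau\Big)^{1/2},$$ $$\|f\|_{W^s}=\|f\|_{Y^{s,-1/2}}+\Big(\sum_{n\in\mathbb Z}\Big(\int_{\mathbb R}\frac{\langle n\rangle^s|\widehat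 f(n,\tau)|}{\langle\tau-n^3\rangle}d\tau\Big)^2\Big)^{1/2}.$$ Let $k,s\in\mathbb R$. (1) If $k>0$, $1+s\le 4k$ and $k-s\ge-\tfrac12$, then there are $\varepsilon_0>0$ and $C<\infty$, depending only on $k$ and $s$, such that for all $0<\varepsilon\le\varepsilon_0$ and all $u_1,u_2\in L^2(\mathbb T\times\mathbb R)$ $$\|\partial_x(u_1\overline{u_2})\|_{W^s}\le C\Big(\|u_1\|_{X^{k,\frac12-\varepsilon}}\|u_2\|_{X^{k,\frac12}}+\|u_1\|_{X^{k,\frac12}}\|u_2\|_{X^{k,\frac12-\varepsilon}}\Big).\qquad(*)$$ (2) If $1+s>4k$ or $k-s<-\tfrac12$, then for every $\varepsilon>0$ there is no $C<\infty$ for which $(*)$ holds for all $u_1,u_2\in L^2(\mathbb T\times\mathbb R)$. (3) More precisely, if there is a $C<\infty$ such that $\|\partial_x(u_1\overline{u_2})\|_{Y^{s,-1/2}}\le C\|u_1\|_{X^{k,1/2}}\|u_2\|_{X^{k,1/2}}$ for all $u_1,u_2\in L^2(\mathbb T\times\mathbb R)$, then $1+s\le4k$ and $k-s\ge-\tfrac12$.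 -/

import Mathlib

open MeasureTheory
open scoped ENNReal NNReal FourierTransform ComplexConjugate

noncomputable section

namespace NLSKdV

instance factTwoPiPos : Fact (0 < 2 * Real.pi) := ⟨Real.two_pi_pos⟩

/-- The circle `ℝ / 2πℤ`; its `volume` is Lebesgue measure `dx`, of total mass `2π`. -/
abbrev Torus : Type := AddCircle (2 * Real.pi)

/-- Square-integrable functions `u(x, t)` on `𝕋 × ℝ`, with respect to `dx dt`. -/
abbrev L2 : Type := Lp ℂ 2 (volume : Measure (Torus × ℝ))

/-- The bracket `⟨y⟩ = 1 + |y|`. -/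
def bracket (y : ℝ) : ℝ := 1 + |y|

/-- The Fourier transform in both variables of an integrable function `w` on `𝕋 × ℝ`,
`ŵ(n, τ) = (2π)⁻¹ ∫ e^{-itτ} e^{-ixn} w(x, t) dt dx`
(recall that `fourier (-n) x = e^{-inx}` on `ℝ / 2πℤ`). -/
def fourierL1 (w : Torus × ℝ → ℂ) (n : ℤ) (τ : ℝ) : ℂ :=
  (2 * Real.pi : ℂ)⁻¹ *
    ∫ p : Torus × ℝ, Complex.exp (-(Complex.I * p.2 * τ)) * fourier (-n) p.1 * w p

/-- The unnormalised Fourier coefficient in `x`: `t ↦ ∫_𝕋 e^{-inx} u(x, t) dx`. -/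
def xCoeff (u : Torus × ℝ → ℂ) (n : ℤ) (t : ℝ) : ℂ :=
  ∫ x : Torus, fourier (-n) x * u (x, t)

theorem memLp_xCoeff (u : L2) (n : ℤ) : MemLp (xCoeff u n) 2 (volume : Measure ℝ) := by
  have hu : MemLp (u : Torus × ℝ → ℂ) 2 (volume : Measure (Torus × ℝ)) := Lp.memLp u
  have hm : AEStronglyMeasurable (fun p : ℝ × Torus => fourier (-n) p.2 * u (p.2, p.1))
      ((volume : Measure ℝ).prod (volume : Measure Torus)) := by
    refine AEStronglyMeasurable.mul ?_ ?_
    · exact ((map_continuous (fourier (-n))).comp continuous_snd).aestronglyMeasurable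
    · exact hu.1.comp_measurePreserving
        (Measure.measurePreserving_swap (μ := (volume : Measure ℝ)) (ν := (volume : Measure Torus)))
  refine ⟨hm.integral_prod_right', ?_⟩
  have hfin : ∫⁻ p, ‖u p‖ₑ ^ 2 ∂((volume : Measure Torus).prod (volume : Measure ℝ)) < ∞ := by
    have h := (eLpNorm_lt_top_iff_lintegral_rpow_enorm_lt_top (p := 2)
      (by norm_num) (by norm_num)).1 hu.2
    simpa using! h
  refine (eLpNorm_lt_top_iff_lintegral_rpow_enorm_lt_top (by norm_num) (by norm_num)).2 ?_
  have hme : AEMeasurable (fun p => ‖u p‖ₑ ^ 2)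
      ((volume : Measure Torus).prod (volume : Measure ℝ)) := hu.1.enorm.pow_const 2
  have hsw := lintegral_prod_symm _ hme
  have hpt : ∀ t : ℝ, AEMeasurable (fun x => ‖u (x, t)‖ₑ) (volume : Measure Torus) →
      ‖xCoeff u n t‖ₑ ^ (2 : ℝ) ≤
        (volume (Set.univ : Set Torus)) * ∫⁻ x, ‖u (x, t)‖ₑ ^ 2 := by
    intro t ht
    have h1 : ‖xCoeff u n t‖ₑ ≤ ∫⁻ x, ‖u (x, t)‖ₑ := by
      refine (enorm_integral_le_lintegral_enorm _).trans (le_of_eq ?_)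
      refine lintegral_congr fun x => ?_
      have : ‖(fourier (-n) x : ℂ)‖ₑ = 1 := by
        rw [← ofReal_norm, fourier_apply, Circle.norm_coe, ENNReal.ofReal_one]
      rw [enorm_mul, this, one_mul]
    have h2 := ENNReal.lintegral_mul_le_Lp_mul_Lq (volume : Measure Torus)
      Real.HolderConjugate.two_two ht (aemeasurable_const (b := (1 : ℝ≥0∞)))
    have h3 : ‖xCoeff u n t‖ₑ ≤ (∫⁻ x, ‖u (x, t)‖ₑ ^ (2 : ℝ)) ^ (1 / (2 : ℝ)) *
        (volume (Set.univ : Set Torus)) ^ (1 / (2 : ℝ)) := by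
      refine h1.trans ?_
      simpa using! h2
    refine (ENNReal.rpow_le_rpow h3 (by norm_num : (0 : ℝ) ≤ 2)).trans (le_of_eq ?_)
    rw [ENNReal.mul_rpow_of_nonneg _ _ (by norm_num), ← ENNReal.rpow_mul, ← ENNReal.rpow_mul]
    norm_num
    rw [mul_comm]
  have hae : ∀ᵐ t : ℝ, AEMeasurable (fun x => ‖u (x, t)‖ₑ) (volume : Measure Torus) := by
    have h0 := (hu.1.comp_measurePreserving (Measure.measurePreserving_swap
      (μ := (volume : Measure ℝ)) (ν := (volume : Measure Torus)))).prodMk_left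
    filter_upwards [h0] with t ht using ht.enorm
  have hle : ∫⁻ t, ‖xCoeff u n t‖ₑ ^ (2 : ℝ) ≤
      ∫⁻ t : ℝ, (volume (Set.univ : Set Torus)) * ∫⁻ x, ‖u (x, t)‖ₑ ^ 2 :=
    lintegral_mono_ae (hae.mono fun t ht => hpt t ht)
  have hle' : ∫⁻ t, ‖xCoeff u n t‖ₑ ^ (2 : ℝ≥0∞).toReal ≤
      ∫⁻ t : ℝ, (volume (Set.univ : Set Torus)) * ∫⁻ x, ‖u (x, t)‖ₑ ^ 2 := by
    rw [ENNReal.toReal_ofNat]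
    exact hle
  refine lt_of_le_of_lt hle' ?_
  rw [lintegral_const_mul' _ _ (measure_ne_top _ _), ← hsw]
  exact ENNReal.mul_lt_top (measure_lt_top _ _) hfin

/-- The Fourier transform in both variables of `u ∈ L²(𝕋 × ℝ)`, with the normalisation of
`fourierL1`: the Fourier coefficients in `x`, followed by the (Plancherel) Fourier transform in
`t`. The latter is Mathlib's, with kernel `e^{-2πitσ}`, evaluated at `σ = τ / (2π)`. -/
def fourierL2 (u : L2) (n : ℤ) (τ : ℝ) : ℂ :=
  (2 * Real.pi : ℂ)⁻¹ *
    (𝓕 ((memLp_xCoeff u n).toLp (xCoeff u n)) : Lp ℂ 2 (volume : Measure ℝ)) (τ / (2 * Real.pi))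

/-- The pointwise product `u₁ ū₂`. -/
def mulConj (u₁ u₂ : L2) (p : Torus × ℝ) : ℂ := u₁ p * conj (u₂ p)

/-- The product `u₁ ū₂` of two square-integrable functions is integrable, so that its Fourier
transform is given by the integral in `fourierL1`. -/
theorem integrable_mulConj (u₁ u₂ : L2) : Integrable (mulConj u₁ u₂) := by
  have h := MemLp.integrable_mul (Lp.memLp u₁) (Lp.memLp u₂).star
  exact h

/-- The Fourier transform of the distributional derivative `∂ₓ w` of an integrable function `w`
on `𝕋 × ℝ`: testing against `e^{-i(nx + tτ)}`,
`-(2π)⁻¹ ∫ w ∂ₓ e^{-i(nx + tτ)} dt dx = i n ŵ(n, τ)`. -/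
def fourierDx (w : Torus × ℝ → ℂ) (n : ℤ) (τ : ℝ) : ℂ :=
  Complex.I * n * fourierL1 w n τ

/-- The norm of `X^{k,b}`, with values in `[0, ∞]`, of a function or distribution on `𝕋 × ℝ`
with Fourier transform `F`:
`(∑ₙ ∫ ⟨n⟩^{2k} ⟨τ + n²⟩^{2b} |F(n, τ)|² dτ)^{1/2}`. -/
def normX (k b : ℝ) (F : ℤ → ℝ → ℂ) : ℝ≥0∞ :=
  (∑' n : ℤ, ∫⁻ τ : ℝ,
    ENNReal.ofReal (bracket n ^ (2 * k) * bracket (τ + (n : ℝ) ^ 2) ^ (2 * b)) * ‖F n τ‖ₑ ^ 2)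
      ^ (1 / 2 : ℝ)

/-- The norm of `Y^{s,b}`, with values in `[0, ∞]`, of a function or distribution on `𝕋 × ℝ`
with Fourier transform `F`:
`(∑ₙ ∫ ⟨n⟩^{2s} ⟨τ - n³⟩^{2b} |F(n, τ)|² dτ)^{1/2}`. -/
def normY (s b : ℝ) (F : ℤ → ℝ → ℂ) : ℝ≥0∞ :=
  (∑' n : ℤ, ∫⁻ τ : ℝ,
    ENNReal.ofReal (bracket n ^ (2 * s) * bracket (τ - (n : ℝ) ^ 3) ^ (2 * b)) * ‖F n τ‖ₑ ^ 2)
      ^ (1 / 2 : ℝ)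

/-- The norm of `W^s`, with values in `[0, ∞]`, of a function or distribution on `𝕋 × ℝ`
with Fourier transform `F`: the `Y^{s,-1/2}` norm plus the `L²ₙ L¹_τ` norm of
`⟨n⟩^s F(n, τ) / ⟨τ - n³⟩`. -/
def normW (s : ℝ) (F : ℤ → ℝ → ℂ) : ℝ≥0∞ :=
  normY s (-1 / 2) F +
    (∑' n : ℤ, (∫⁻ τ : ℝ,
      ENNReal.ofReal (bracket n ^ s / bracket (τ - (n : ℝ) ^ 3)) * ‖F n τ‖ₑ) ^ 2) ^ (1 / 2 : ℝ)

/-- The bilinear estimate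
`‖∂ₓ(u₁ ū₂)‖_{W^s} ≤ C (‖u₁‖_{X^{k,1/2-ε}} ‖u₂‖_{X^{k,1/2}} + ‖u₁‖_{X^{k,1/2}} ‖u₂‖_{X^{k,1/2-ε}})`
for all `u₁, u₂`. -/
def EstimateW (k s ε : ℝ) (C : ℝ≥0) : Prop :=
  ∀ u₁ u₂ : L2,
    normW s (fourierDx (mulConj u₁ u₂)) ≤
      C * (normX k (1 / 2 - ε) (fourierL2 u₁) * normX k (1 / 2) (fourierL2 u₂) +
        normX k (1 / 2) (fourierL2 u₁) * normX k (1 / 2 - ε) (fourierL2 u₂))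

/-- The bilinear estimate
`‖∂ₓ(u₁ ū₂)‖_{Y^{s,-1/2}} ≤ C ‖u₁‖_{X^{k,1/2}} ‖u₂‖_{X^{k,1/2}}` for all `u₁, u₂`. -/
def EstimateY (k s : ℝ) (C : ℝ≥0) : Prop :=
  ∀ u₁ u₂ : L2,
    normY s (-1 / 2) (fourierDx (mulConj u₁ u₂)) ≤
      C * (normX k (1 / 2) (fourierL2 u₁) * normX k (1 / 2) (fourierL2 u₂))

end NLSKdV

end

/-!
The estimate is a weighted estimate for a correlation. By Parseval on the circle and on the line,
the Fourier transform of `u₁ ū₂` at `(n, τ)` is, up to a constant, the sum over `m` and the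
integral over `σ` of `û₁(m, σ)` times the conjugate of `û₂(m - n, σ - τ)` (`fourierL1_mulConj`).
The modulations of the two inputs and of the output satisfy the resonance identity

`(σ + m²) - (σ - τ + (m - n)²) - (τ - n³) = n³ + m² - (m - n)² = 2n (m + (n² - n) / 2)`,

so that one of them is, in absolute value, at least a third of the right-hand side, the resonance
function.

*Sufficiency.* Half a power of the resonance function is used to pay for the derivative. What
remains is the multiplier `weight`, whose square is bounded, with a little decay, in
`weight_sq_le`. Where `|m + (n² - n) / 2| ≤ n² / 8`, both input frequencies are at least of size
`n²`, and `1 + s ≤ 4k` suffices; elsewhere the resonance function is at least of size `|n|³`, and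
`k - s ≥ -1/2` suffices. The half power is then distributed over the three modulations
(`rpow_modulation_le`, `inv_modulation_le`), which gives one kernel for each of them, and each
kernel is treated by a single application of the Cauchy–Schwarz inequality. If the output
modulation dominates, the kernel is square-summable in the input variables, because of the
arithmetic progression `2nm` (`exists_tsum_bracket_mul_le`). If an input modulation dominates, the
kernel is square-summable in the output variables, because the values of a monic cubic at the
integers are spread out like the cubes (`exists_tsum_bracket_cubic_le`). All exponents have some
room, which leaves `δ` on the weaker input norm. Since the right-hand side decreases with `ε`, one
value of `δ` gives the estimate for all smaller ones.

*Necessity.* The `Y^{s,-1/2}` estimate is tested on functions whose Fourier transforms are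
indicators of unit neighbourhoods of two points of the parabola `τ = -n²` (`EstimateY.le_mul`). The
exactly resonant frequencies `l - 2l²`, `-l - 2l²` give `1 + s ≤ 4k`, and the frequencies `l`, `0`
give `k - s ≥ -1/2`. The failure of the `W^s` estimate follows, since it is stronger than the
`Y^{s,-1/2}` estimate.
-/

noncomputable section

namespace NLSKdV

/-! ### Parseval identities on the line and on the circle -/

/-- Parseval on the line for the pair `g₁`, `e^{2πist} g₂`, the modulation becoming a translation on
the Fourier side. Both sides are inner products depending continuously on `g₁`, so it is enough to
treat Schwartz functions. -/
theorem integral_modulation_mul_conj (g₁ g₂ : Lp ℂ 2 (volume : Measure ℝ)) (s : ℝ) :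
    ∫ t : ℝ, Complex.exp (-(2 * Real.pi * Complex.I * s * t)) * g₁ t * conj (g₂ t) =
      ∫ ξ : ℝ, (𝓕 g₁ : Lp ℂ 2 (volume : Measure ℝ)) ξ *
        conj ((𝓕 g₂ : Lp ℂ 2 (volume : Measure ℝ)) (ξ - s)) := by
  have hE : ∀ t : ℝ, ‖Complex.exp (-(2 * Real.pi * Complex.I * s * t))‖ = 1 := fun t => by
    rw [Complex.norm_exp]; simp
  have hEc : Continuous fun t : ℝ => Complex.exp (-(2 * Real.pi * Complex.I * s * t)) := by
    fun_prop
  have hm : MemLp (fun t : ℝ => conj (Complex.exp (-(2 * Real.pi * Complex.I * s * t))) * g₂ t) 2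
      volume := by
    refine (Lp.memLp g₂).of_le (((Complex.continuous_conj.comp hEc).aestronglyMeasurable).mul
      (Lp.aestronglyMeasurable g₂)) (.of_forall fun t => ?_)
    rw [norm_mul, RCLike.norm_conj, hE, one_mul]
  have hp : MeasurePreserving (fun x : ℝ => x - s) volume volume :=
    measurePreserving_sub_right volume s
  set T : Lp ℂ 2 (volume : Measure ℝ) := Lp.compMeasurePreserving (fun x : ℝ => x - s) hp (𝓕 g₂)
    with hT
  have hTc : T =ᵐ[volume] fun ξ => (𝓕 g₂ : Lp ℂ 2 (volume : Measure ℝ)) (ξ - s) :=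
    Lp.coeFn_compMeasurePreserving _ hp
  have hL : ∀ g : Lp ℂ 2 (volume : Measure ℝ),
      ∫ t : ℝ, Complex.exp (-(2 * Real.pi * Complex.I * s * t)) * g t * conj (g₂ t) =
        inner ℂ (hm.toLp _) g := fun g => by
    rw [L2.inner_def]
    refine integral_congr_ae ?_
    filter_upwards [hm.coeFn_toLp] with t ht
    rw [ht, RCLike.inner_apply, map_mul, Complex.conj_conj]
    ring
  have hR : ∀ g : Lp ℂ 2 (volume : Measure ℝ),
      ∫ ξ : ℝ, (𝓕 g : Lp ℂ 2 (volume : Measure ℝ)) ξ *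
        conj ((𝓕 g₂ : Lp ℂ 2 (volume : Measure ℝ)) (ξ - s)) = inner ℂ T (𝓕 g) := fun g => by
    rw [L2.inner_def]
    refine integral_congr_ae ?_
    filter_upwards [hTc] with t ht
    rw [ht, RCLike.inner_apply]
  rw [hL, hR]
  refine DenseRange.induction_on
    (p := fun g : Lp ℂ 2 (volume : Measure ℝ) => inner ℂ (hm.toLp _) g = inner ℂ T (𝓕 g))
    (SchwartzMap.denseRange_toLpCLM (E := ℝ) (F := ℂ) (p := 2) ENNReal.ofNat_ne_top) g₁
    ?_ fun f => ?_
  · exact isClosed_eq (by fun_prop)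
      ((continuous_const.inner (𝕜 := ℂ) FourierTransform.continuous_fourier))
  · -- the modulation of a Schwartz function, realised on the Fourier side as a translation
    set h : SchwartzMap ℝ ℂ := 𝓕⁻ (SchwartzMap.compSubConstCLM ℂ (-s) (𝓕 f)) with hh
    have hpt : ∀ t : ℝ, h t = Complex.exp (-(2 * Real.pi * Complex.I * s * t)) * f t := fun t => by
      rw [hh, SchwartzMap.fourierInv_coe, Real.fourierInv_eq']
      have h1 : (f : ℝ → ℂ) t = 𝓕⁻ (𝓕 (f : ℝ → ℂ)) t := by
        rw [← SchwartzMap.fourier_coe, ← SchwartzMap.fourierInv_coe,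
          FourierTransform.fourierInv_fourier_eq]
      rw [h1, Real.fourierInv_eq', ← integral_const_mul,
        ← integral_sub_right_eq_self _ s]
      refine integral_congr_ae (.of_forall fun v => ?_)
      simp only [SchwartzMap.compSubConstCLM_apply, SchwartzMap.fourier_coe, smul_eq_mul,
        sub_neg_eq_add, sub_add_cancel, ← mul_assoc, ← Complex.exp_add]
      congr 2
      simp
      ring
    have h1 : inner ℂ (hm.toLp _) (f.toLp 2 volume) = inner ℂ g₂ (h.toLp 2 volume) := by
      rw [L2.inner_def, L2.inner_def]
      refine integral_congr_ae ?_
      filter_upwards [hm.coeFn_toLp, f.coeFn_toLp 2 volume, h.coeFn_toLp 2 volume] with t h1 h2 h3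
      rw [h1, h2, h3, hpt, RCLike.inner_apply, RCLike.inner_apply, map_mul, Complex.conj_conj]
      ring
    change inner ℂ (hm.toLp _) (f.toLp 2 volume) = inner ℂ T (𝓕 (f.toLp 2 volume))
    rw [h1, ← Lp.inner_fourier_eq, SchwartzMap.toLp_fourier_eq, SchwartzMap.toLp_fourier_eq, hh,
      FourierTransform.fourier_fourierInv_eq, L2.inner_def, L2.inner_def,
      ← integral_sub_right_eq_self _ s]
    refine integral_congr_ae ?_
    filter_upwards [hTc, (𝓕 f).coeFn_toLp 2 volume,
      hp.quasiMeasurePreserving.ae ((SchwartzMap.compSubConstCLM ℂ (-s) (𝓕 f)).coeFn_toLp 2 volume)]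
      with t h1 h2 h3
    rw [h1, h2, h3, SchwartzMap.compSubConstCLM_apply, sub_neg_eq_add, sub_add_cancel]

/-- Parseval on the circle `ℝ / 2πℤ` for the pair `f`, `e^{inx} g`: the unnormalised Fourier
coefficient of `f ḡ`, times `2π`, is the correlation of the coefficients of `f` and `g`. -/
theorem hasSum_integral_fourier_mul_conj {f g : Torus → ℂ} (hf : MemLp f 2 volume)
    (hg : MemLp g 2 volume) (n : ℤ) :
    HasSum (fun m : ℤ => (∫ x : Torus, fourier (-m) x * f x) *
      conj (∫ x : Torus, fourier (-(m - n)) x * g x))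
      (2 * Real.pi * ∫ x : Torus, fourier (-n) x * (f x * conj (g x))) := by
  have hco : ∀ (F : Torus → ℂ) (m : ℤ), ∫ x : Torus, fourier (-m) x * F x =
      2 * Real.pi * fourierCoeff F m := fun F m => by
    rw [fourierCoeff, AddCircle.integral_haarAddCircle]
    simp only [smul_eq_mul, Complex.real_smul]
    have := Real.pi_ne_zero
    push_cast
    field_simp
  have hgn : MemLp (fun x : Torus => fourier n x * g x) 2 volume := by
    refine hg.of_le (((map_continuous (fourier n)).aestronglyMeasurable).mul hg.1)
      (.of_forall fun x => ?_)
    rw [norm_mul, fourier_apply, Circle.norm_coe, one_mul]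
  have h := fourierBasis.hasSum_inner_mul_inner (hgn.haarAddCircle.toLp _) (hf.haarAddCircle.toLp _)
  have hfr : ∀ m, inner ℂ (fourierBasis m) (hf.haarAddCircle.toLp f) = fourierCoeff f m :=
      fun m => by
    rw [← HilbertBasis.repr_apply_apply, fourierBasis_repr,
      fourierCoeff_congr_ae hf.haarAddCircle.coeFn_toLp]
  have hgr : ∀ m, inner ℂ (hgn.haarAddCircle.toLp _) (fourierBasis m) =
      conj (fourierCoeff g (m - n)) := fun m => by
    rw [← inner_conj_symm, ← HilbertBasis.repr_apply_apply, fourierBasis_repr,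
      fourierCoeff_congr_ae hgn.haarAddCircle.coeFn_toLp]
    simp only [fourierCoeff, smul_eq_mul, ← mul_assoc, ← fourier_add]
    congr! 6
    ring
  simp only [hfr, hgr] at h
  have hI : inner ℂ (hgn.haarAddCircle.toLp _) (hf.haarAddCircle.toLp f) =
      fourierCoeff (fun x => f x * conj (g x)) n := by
    rw [L2.inner_def, fourierCoeff]
    refine integral_congr_ae ?_
    filter_upwards [hgn.haarAddCircle.coeFn_toLp, hf.haarAddCircle.coeFn_toLp] with x h1 h2
    rw [h1, h2, RCLike.inner_apply, map_mul, fourier_neg, smul_eq_mul]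
    ring
  rw [hI] at h
  rw [hco]
  convert! (h.mul_left ((2 * Real.pi : ℂ) ^ 2)) using 1
  · funext m
    rw [hco, hco]
    simp only [map_mul, Complex.conj_ofReal, map_ofNat]
    ring
  · ring

/-! ### The Fourier transform of a product as a correlation -/

theorem ae_memLp_slice (u : L2) :
    ∀ᵐ t : ℝ, MemLp (fun x : Torus => u (x, t)) 2 volume := by
  have hu : MemLp (u : Torus × ℝ → ℂ) 2 (volume : Measure (Torus × ℝ)) := Lp.memLp u
  have h0 := (hu.1.comp_measurePreserving (Measure.measurePreserving_swap
      (μ := (volume : Measure ℝ)) (ν := (volume : Measure Torus)))).prodMk_left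
  have hfin : ∫⁻ p, ‖u p‖ₑ ^ (2 : ℝ) ∂((volume : Measure Torus).prod (volume : Measure ℝ)) < ∞ := by
    have h := (eLpNorm_lt_top_iff_lintegral_rpow_enorm_lt_top (p := 2)
      (by norm_num) (by norm_num)).1 hu.2
    simpa using! h
  have hme : AEMeasurable (fun p => ‖u p‖ₑ ^ (2 : ℝ))
      ((volume : Measure Torus).prod (volume : Measure ℝ)) := hu.1.enorm.pow_const 2
  rw [lintegral_prod_symm _ hme] at hfin
  filter_upwards [h0, ae_lt_top' hme.lintegral_prod_left' hfin.ne] with t ht ht'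
  refine ⟨ht, (eLpNorm_lt_top_iff_lintegral_rpow_enorm_lt_top (by norm_num) (by norm_num)).2 ?_⟩
  rw [ENNReal.toReal_ofNat]
  exact ht'

/-- Plancherel in the space variable; it justifies the interchange of the sum over the frequencies
with the time integral in `fourierL1_mulConj`. -/
theorem tsum_lintegral_xCoeff_lt_top (u : L2) :
    ∑' m : ℤ, ∫⁻ t : ℝ, ‖xCoeff u m t‖ₑ ^ 2 < ∞ := by
  rw [← lintegral_tsum fun m => ((memLp_xCoeff u m).1.enorm.pow_const 2)]
  have hu : MemLp (u : Torus × ℝ → ℂ) 2 (volume : Measure (Torus × ℝ)) := Lp.memLp u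
  have hfin : ∫⁻ p, ‖u p‖ₑ ^ 2 ∂((volume : Measure Torus).prod (volume : Measure ℝ)) < ∞ := by
    have h := (eLpNorm_lt_top_iff_lintegral_rpow_enorm_lt_top (p := 2)
      (by norm_num) (by norm_num)).1 hu.2
    simpa using! h
  have hme : AEMeasurable (fun p => ‖u p‖ₑ ^ 2)
      ((volume : Measure Torus).prod (volume : Measure ℝ)) := hu.1.enorm.pow_const 2
  rw [lintegral_prod_symm _ hme] at hfin
  have h : ∀ᵐ t : ℝ, ∑' m : ℤ, ‖xCoeff u m t‖ₑ ^ 2 =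
      ENNReal.ofReal (2 * Real.pi) * ∫⁻ x : Torus, ‖u (x, t)‖ₑ ^ 2 := by
    filter_upwards [ae_memLp_slice u] with t ht
    have h1 := hasSum_integral_fourier_mul_conj ht ht 0
    have h2 : HasSum (fun m : ℤ => ‖xCoeff u m t‖ ^ 2)
        (2 * Real.pi * ∫ x : Torus, ‖u (x, t)‖ ^ 2) := by
      rw [← Complex.hasSum_ofReal]
      convert! h1 using 1
      · funext m
        rw [sub_zero, Complex.mul_conj, Complex.normSq_eq_norm_sq]
        rfl
      · push_cast
        rw [← integral_complex_ofReal]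
        simp [Complex.mul_conj, Complex.normSq_eq_norm_sq]
    have h3 := ENNReal.ofReal_tsum_of_nonneg (fun m => sq_nonneg _) h2.summable
    rw [h2.tsum_eq, ENNReal.ofReal_mul (by positivity),
      ofReal_integral_eq_lintegral_ofReal ht.norm.integrable_sq (.of_forall fun x => sq_nonneg _)]
      at h3
    simp only [ENNReal.ofReal_pow (norm_nonneg _), ofReal_norm] at h3
    exact h3.symm
  rw [lintegral_congr_ae h, lintegral_const_mul' _ _ ENNReal.ofReal_ne_top]
  exact ENNReal.mul_lt_top ENNReal.ofReal_lt_top hfin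

/-- `integral_modulation_mul_conj` for the Fourier coefficients in `x`, in the normalisation of
`fourierL2`. -/
theorem integral_exp_mul_xCoeff (u₁ u₂ : L2) (m m' : ℤ) (τ : ℝ) :
    ∫ t : ℝ, Complex.exp (-(Complex.I * t * τ)) * (xCoeff u₁ m t * conj (xCoeff u₂ m' t)) =
      2 * Real.pi * ∫ σ : ℝ, fourierL2 u₁ m σ * conj (fourierL2 u₂ m' (σ - τ)) := by
  have hpi := Real.pi_ne_zero
  have hpi' : (Real.pi : ℂ) ≠ 0 := by exact_mod_cast hpi
  have h := integral_modulation_mul_conj ((memLp_xCoeff u₁ m).toLp (xCoeff u₁ m))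
    ((memLp_xCoeff u₂ m').toLp (xCoeff u₂ m')) (τ / (2 * Real.pi))
  have hl : ∫ t : ℝ, Complex.exp (-(Complex.I * t * τ)) * (xCoeff u₁ m t * conj (xCoeff u₂ m' t)) =
      ∫ t : ℝ, Complex.exp (-(2 * Real.pi * Complex.I * (τ / (2 * Real.pi) : ℝ) * t)) *
        (memLp_xCoeff u₁ m).toLp (xCoeff u₁ m) t *
          conj ((memLp_xCoeff u₂ m').toLp (xCoeff u₂ m') t) := by
    refine integral_congr_ae ?_
    filter_upwards [(memLp_xCoeff u₁ m).coeFn_toLp, (memLp_xCoeff u₂ m').coeFn_toLp] with t h1 h2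
    have h3 : Complex.I * t * τ = 2 * Real.pi * Complex.I * (τ / (2 * Real.pi) : ℝ) * t := by
      push_cast
      field_simp
    rw [h1, h2, h3, mul_assoc (Complex.exp _)]
  rw [hl, h]
  have h2 := Measure.integral_comp_div (fun ξ : ℝ =>
    (𝓕 ((memLp_xCoeff u₁ m).toLp (xCoeff u₁ m)) : Lp ℂ 2 (volume : Measure ℝ)) ξ *
      conj ((𝓕 ((memLp_xCoeff u₂ m').toLp (xCoeff u₂ m')) : Lp ℂ 2 (volume : Measure ℝ))
        (ξ - τ / (2 * Real.pi)))) (2 * Real.pi)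
  rw [abs_of_pos Real.two_pi_pos, Complex.real_smul] at h2
  have h3 : ∫ σ : ℝ, fourierL2 u₁ m σ * conj (fourierL2 u₂ m' (σ - τ)) =
      ((2 * Real.pi : ℂ)⁻¹) ^ 2 * ∫ σ : ℝ, (𝓕 ((memLp_xCoeff u₁ m).toLp (xCoeff u₁ m)) : Lp ℂ 2
          (volume : Measure ℝ)) (σ / (2 * Real.pi)) *
        conj ((𝓕 ((memLp_xCoeff u₂ m').toLp (xCoeff u₂ m')) : Lp ℂ 2 (volume : Measure ℝ))
          (σ / (2 * Real.pi) - τ / (2 * Real.pi))) := by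
    rw [← integral_const_mul]
    refine integral_congr_ae (.of_forall fun σ => ?_)
    simp only [fourierL2, map_mul, map_inv₀, Complex.conj_ofReal, map_ofNat, sub_div]
    ring
  rw [h3, h2, Complex.ofReal_mul, Complex.ofReal_ofNat, ← mul_assoc, ← mul_assoc]
  have h4 : (2 * Real.pi : ℂ) * (2 * Real.pi : ℂ)⁻¹ ^ 2 * (2 * Real.pi) = 1 := by field_simp
  rw [h4, one_mul]

/-- The Fourier transform of `u₁ ū₂` is the correlation of the transforms: the inner sum comes from
Parseval on the circle on almost every time slice, the inner integral from Parseval on the line. -/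
theorem fourierL1_mulConj (u₁ u₂ : L2) (n : ℤ) (τ : ℝ) :
    fourierL1 (mulConj u₁ u₂) n τ = (2 * Real.pi : ℂ)⁻¹ *
      ∑' m : ℤ, ∫ σ : ℝ, fourierL2 u₁ m σ * conj (fourierL2 u₂ (m - n) (σ - τ)) := by
  have hpi' : (Real.pi : ℂ) ≠ 0 := by exact_mod_cast Real.pi_ne_zero
  have hint : Integrable (fun p : Torus × ℝ =>
      Complex.exp (-(Complex.I * p.2 * τ)) * fourier (-n) p.1 * mulConj u₁ u₂ p)
      ((volume : Measure Torus).prod (volume : Measure ℝ)) := by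
    refine (integrable_mulConj u₁ u₂).mono ?_ (.of_forall fun p => ?_)
    · refine AEStronglyMeasurable.mul ?_ (integrable_mulConj u₁ u₂).1
      exact Continuous.aestronglyMeasurable (by fun_prop)
    · rw [norm_mul, norm_mul, fourier_apply, Circle.norm_coe, Complex.norm_exp]
      simp
  have hsl : ∫ p : Torus × ℝ,
      Complex.exp (-(Complex.I * p.2 * τ)) * fourier (-n) p.1 * mulConj u₁ u₂ p =
      ∫ t : ℝ, ∑' m : ℤ, (2 * Real.pi : ℂ)⁻¹ * (Complex.exp (-(Complex.I * t * τ)) *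
        (xCoeff u₁ m t * conj (xCoeff u₂ (m - n) t))) := by
    refine (integral_prod_symm _ hint).trans (integral_congr_ae ?_)
    filter_upwards [ae_memLp_slice u₁, ae_memLp_slice u₂] with t h1 h2
    have h := hasSum_integral_fourier_mul_conj h1 h2 n
    have h' := (h.mul_left (Complex.exp (-(Complex.I * t * τ)))).mul_left (2 * Real.pi : ℂ)⁻¹
    refine Eq.trans ?_ h'.tsum_eq.symm
    simp only [mulConj, mul_assoc]
    rw [integral_const_mul]
    field_simp
  have hsum : ∑' m : ℤ, ∫⁻ t : ℝ, ‖(2 * Real.pi : ℂ)⁻¹ * (Complex.exp (-(Complex.I * t * τ)) *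
        (xCoeff u₁ m t * conj (xCoeff u₂ (m - n) t)))‖ₑ ≠ ∞ := by
    have hb : ∀ m : ℤ, ∫⁻ t : ℝ, ‖(2 * Real.pi : ℂ)⁻¹ * (Complex.exp (-(Complex.I * t * τ)) *
        (xCoeff u₁ m t * conj (xCoeff u₂ (m - n) t)))‖ₑ ≤ ‖(2 * Real.pi : ℂ)⁻¹‖ₑ *
          ((∫⁻ t : ℝ, ‖xCoeff u₁ m t‖ₑ ^ 2) + ∫⁻ t : ℝ, ‖xCoeff u₂ (m - n) t‖ₑ ^ 2) := fun m => by
      rw [← lintegral_add_left' ((memLp_xCoeff u₁ m).1.enorm.pow_const 2),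
        ← lintegral_const_mul' _ _ enorm_ne_top]
      refine lintegral_mono fun t => ?_
      rw [enorm_mul]
      gcongr
      have he : ‖Complex.exp (-(Complex.I * t * τ))‖ₑ = 1 := by
        rw [← ofReal_norm, Complex.norm_exp]; simp
      rw [enorm_mul, he, one_mul, enorm_mul, RCLike.enorm_conj]
      rcases le_total ‖xCoeff u₁ m t‖ₑ ‖xCoeff u₂ (m - n) t‖ₑ with hle | hle
      · exact le_trans (by rw [sq]; gcongr) le_add_self
      · exact le_trans (by rw [sq]; gcongr) le_self_add
    refine ((ENNReal.tsum_le_tsum hb).trans_lt ?_).ne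
    rw [ENNReal.tsum_mul_left, ENNReal.tsum_add]
    refine ENNReal.mul_lt_top enorm_lt_top (ENNReal.add_lt_top.2
      ⟨tsum_lintegral_xCoeff_lt_top u₁, ?_⟩)
    have := (Equiv.subRight n).tsum_eq fun m : ℤ => ∫⁻ t : ℝ, ‖xCoeff u₂ m t‖ₑ ^ 2
    simp only [Equiv.subRight_apply] at this
    rw [this]
    exact tsum_lintegral_xCoeff_lt_top u₂
  have hmeas : ∀ m : ℤ, AEStronglyMeasurable (fun t : ℝ => (2 * Real.pi : ℂ)⁻¹ *
      (Complex.exp (-(Complex.I * t * τ)) * (xCoeff u₁ m t * conj (xCoeff u₂ (m - n) t))))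
      volume := fun m => by
    refine (AEStronglyMeasurable.mul (Continuous.aestronglyMeasurable (by fun_prop))
      ((memLp_xCoeff u₁ m).1.mul ?_)).const_mul _
    exact Complex.continuous_conj.comp_aestronglyMeasurable (memLp_xCoeff u₂ (m - n)).1
  rw [fourierL1, hsl, integral_tsum hmeas hsum]
  congr 2
  funext m
  rw [integral_const_mul, integral_exp_mul_xCoeff]
  field_simp

/-! ### Functions concentrated near the parabola -/

theorem integral_fourier_neg_mul_fourier (n m : ℤ) :
    ∫ x : Torus, fourier (-n) x * fourier m x = if n = m then (2 * Real.pi : ℂ) else 0 := by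
  have h := congrFun (fourierCoeff_fourier (T := 2 * Real.pi) m) n
  rw [fourierCoeff, AddCircle.integral_haarAddCircle, Complex.real_smul] at h
  have hpi : (Real.pi : ℂ) ≠ 0 := by exact_mod_cast Real.pi_ne_zero
  simp only [smul_eq_mul, Pi.single_apply] at h
  split_ifs at h ⊢ with hnm
  · push_cast at h
    field_simp at h
    exact h
  · push_cast at h
    simpa [hpi] using h

/-- Every square-integrable profile is the Fourier transform, along a single spatial frequency, of
a function in `L²(𝕋 × ℝ)`. -/
theorem exists_fourierL2_eq (n₀ : ℤ) {Φ : ℝ → ℂ} (hΦ : MemLp Φ 2 volume) :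
    ∃ u : L2, fourierL2 u n₀ =ᵐ[volume] (fun τ => Φ (τ / (2 * Real.pi))) ∧
      ∀ n, n ≠ n₀ → fourierL2 u n =ᵐ[volume] 0 := by
  have hpi : (Real.pi : ℂ) ≠ 0 := by exact_mod_cast Real.pi_ne_zero
  set g : Lp ℂ 2 (volume : Measure ℝ) := 𝓕⁻ (hΦ.toLp Φ) with hg
  have hu : MemLp (fun p : Torus × ℝ => fourier n₀ p.1 * g p.2) 2 volume := by
    have h1 : MemLp (fun p : Torus × ℝ => g p.2) 2 volume :=
      (Lp.memLp g).comp_snd (volume : Measure Torus)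
    refine h1.of_le (AEStronglyMeasurable.mul
      (Continuous.aestronglyMeasurable (by fun_prop)) h1.1) (.of_forall fun p => ?_)
    rw [norm_mul, fourier_apply, Circle.norm_coe, one_mul]
  have hx : ∀ n, xCoeff (hu.toLp _) n =ᵐ[volume]
      fun t => (if n = n₀ then (2 * Real.pi : ℂ) else 0) * g t := fun n => by
    have h1 := (Measure.measurePreserving_swap (μ := (volume : Measure ℝ))
      (ν := (volume : Measure Torus))).quasiMeasurePreserving.ae_eq_comp hu.coeFn_toLp
    filter_upwards [Measure.ae_ae_of_ae_prod h1] with t ht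
    rw [xCoeff, ← integral_fourier_neg_mul_fourier, ← integral_mul_const]
    refine integral_congr_ae ?_
    filter_upwards [ht] with x hx
    simp only [Function.comp_apply, Prod.swap_prod_mk] at hx
    rw [hx, mul_assoc]
  have hF : ∀ n, (memLp_xCoeff (hu.toLp _) n).toLp (xCoeff (hu.toLp _) n) =
      (if n = n₀ then (2 * Real.pi : ℂ) else 0) • g := fun n => by
    refine Lp.ext ?_
    filter_upwards [(memLp_xCoeff (hu.toLp _) n).coeFn_toLp, hx n,
      Lp.coeFn_smul (if n = n₀ then (2 * Real.pi : ℂ) else 0) g] with t h1 h2 h3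
    rw [h1, h2, h3, Pi.smul_apply, smul_eq_mul]
  have hq : Measure.QuasiMeasurePreserving (fun τ : ℝ => τ / (2 * Real.pi)) volume volume := by
    have := Measure.quasiMeasurePreserving_smul (volume : Measure ℝ)
      (inv_ne_zero Real.two_pi_pos.ne')
    convert! this using 2
    rw [smul_eq_mul, div_eq_inv_mul]
  have hv : ∀ n, fourierL2 (hu.toLp _) n =ᵐ[volume]
      fun τ => if n = n₀ then Φ (τ / (2 * Real.pi)) else 0 := fun n => by
    have h1 : (𝓕 ((memLp_xCoeff (hu.toLp _) n).toLp (xCoeff (hu.toLp _) n)) :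
        Lp ℂ 2 (volume : Measure ℝ)) =
        (if n = n₀ then (2 * Real.pi : ℂ) else 0) • hΦ.toLp Φ := by
      rw [hF, FourierTransform.fourier_smul, hg, FourierTransform.fourier_fourierInv_eq]
    have h2 := Lp.coeFn_smul (if n = n₀ then (2 * Real.pi : ℂ) else 0) (hΦ.toLp Φ)
    rw [← h1] at h2
    filter_upwards [hq.ae_eq_comp h2, hq.ae_eq_comp hΦ.coeFn_toLp] with τ h3 h4
    simp only [Function.comp_apply] at h3 h4
    rw [fourierL2, h3, Pi.smul_apply, h4, smul_eq_mul]
    split_ifs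
    · field_simp
    · simp
  refine ⟨hu.toLp _, ?_, fun n hn => ?_⟩
  · filter_upwards [hv n₀] with τ h using by rw [h, if_pos rfl]
  · filter_upwards [hv n] with τ h using by rw [h, if_neg hn]; rfl

/-- A function whose Fourier transform is the indicator of the unit neighbourhood of the point
`(n₀, -n₀²)` of the Schrödinger parabola. -/
theorem exists_fourierL2_eq_indicator (n₀ : ℤ) :
    ∃ u : L2, fourierL2 u n₀ =ᵐ[volume]
        (Set.Icc (-(n₀ : ℝ) ^ 2 - 1) (-(n₀ : ℝ) ^ 2 + 1)).indicator 1 ∧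
      ∀ n, n ≠ n₀ → fourierL2 u n =ᵐ[volume] 0 := by
  have hp := Real.two_pi_pos
  have hm : MemLp ((Set.Icc ((-(n₀ : ℝ) ^ 2 - 1) / (2 * Real.pi))
      ((-(n₀ : ℝ) ^ 2 + 1) / (2 * Real.pi))).indicator fun _ => (1 : ℂ)) 2 volume :=
    memLp_indicator_const 2 measurableSet_Icc 1 (Or.inr (by simp))
  obtain ⟨u, h1, h2⟩ := exists_fourierL2_eq n₀ hm
  refine ⟨u, h1.trans (.of_forall fun τ => ?_), h2⟩
  simp only [Set.indicator_apply, Set.mem_Icc, div_le_div_iff_of_pos_right hp, Pi.one_apply]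

theorem one_le_bracket (y : ℝ) : 1 ≤ bracket y := by simp [bracket]

theorem bracket_pos (y : ℝ) : 0 < bracket y := one_pos.trans_le (one_le_bracket y)

theorem normX_sq (k b : ℝ) (F : ℤ → ℝ → ℂ) : normX k b F ^ 2 = ∑' n : ℤ, ∫⁻ τ : ℝ,
    ENNReal.ofReal (bracket n ^ (2 * k) * bracket (τ + (n : ℝ) ^ 2) ^ (2 * b)) * ‖F n τ‖ₑ ^ 2 := by
  rw [normX, ← ENNReal.rpow_natCast, ← ENNReal.rpow_mul]
  norm_num

theorem normY_sq (s b : ℝ) (F : ℤ → ℝ → ℂ) : normY s b F ^ 2 = ∑' n : ℤ, ∫⁻ τ : ℝ,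
    ENNReal.ofReal (bracket n ^ (2 * s) * bracket (τ - (n : ℝ) ^ 3) ^ (2 * b)) * ‖F n τ‖ₑ ^ 2 := by
  rw [normY, ← ENNReal.rpow_natCast, ← ENNReal.rpow_mul]
  norm_num

/-- On the unit neighbourhood of the parabola the modulation weight is at most `2`, so that the norm
only sees the frequency weight. -/
theorem normX_sq_le_of_indicator {k : ℝ} {n₀ : ℤ} {F : ℤ → ℝ → ℂ}
    (h₀ : F n₀ =ᵐ[volume] (Set.Icc (-(n₀ : ℝ) ^ 2 - 1) (-(n₀ : ℝ) ^ 2 + 1)).indicator 1)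
    (h : ∀ n, n ≠ n₀ → F n =ᵐ[volume] 0) :
    normX k (1 / 2) F ^ 2 ≤ ENNReal.ofReal (4 * bracket n₀ ^ (2 * k)) := by
  rw [normX_sq, tsum_eq_single n₀ fun n hn => ?_]
  · calc _ ≤ ∫⁻ τ : ℝ, (Set.Icc (-(n₀ : ℝ) ^ 2 - 1) (-(n₀ : ℝ) ^ 2 + 1)).indicator
          (fun _ => ENNReal.ofReal (2 * bracket n₀ ^ (2 * k))) τ := by
          refine lintegral_mono_ae ?_
          filter_upwards [h₀] with τ hτ
          rw [hτ]
          by_cases hm : τ ∈ Set.Icc (-(n₀ : ℝ) ^ 2 - 1) (-(n₀ : ℝ) ^ 2 + 1)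
          · rw [Set.indicator_of_mem hm, Set.indicator_of_mem hm, Pi.one_apply, enorm_one, one_pow,
              mul_one]
            refine ENNReal.ofReal_le_ofReal ?_
            have hb : bracket (τ + (n₀ : ℝ) ^ 2) ≤ 2 := by
              have : |τ + (n₀ : ℝ) ^ 2| ≤ 1 :=
                abs_le.2 ⟨by linarith [hm.1], by linarith [hm.2]⟩
              rw [bracket]; linarith
            rw [mul_comm, show (2 * (1 / 2) : ℝ) = 1 by norm_num, Real.rpow_one]
            gcongr
            exact (Real.rpow_pos_of_pos (bracket_pos _) _).le
          · simp [Set.indicator_of_notMem hm]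
      _ = ENNReal.ofReal (4 * bracket n₀ ^ (2 * k)) := by
          rw [lintegral_indicator_const measurableSet_Icc, Real.volume_Icc, ← ENNReal.ofReal_mul
            (by have := (Real.rpow_pos_of_pos (bracket_pos n₀) (2 * k)).le; positivity)]
          congr 1; ring
  · refine (lintegral_congr_ae (g := fun _ => 0) ?_).trans lintegral_zero
    filter_upwards [h n hn] with τ hτ
    simp [hτ]

/-- The estimate tested on functions whose Fourier transforms are the indicators of unit
neighbourhoods of two points `(n₁, -n₁²)`, `(n₂, -n₂²)` of the parabola. The transform of the
product is of size one near `(n₁ - n₂, n₂² - n₁²)`, where the modulation of the output is, up to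
sign and a bounded error, the resonance function `n³ + n₁² - n₂²`. -/
theorem EstimateY.le_mul {k s : ℝ} {C : ℝ≥0} (hC : EstimateY k s C) (n₁ n₂ n : ℤ)
    (hn : n = n₁ - n₂) :
    (n : ℝ) ^ 2 * bracket n ^ (2 * s) ≤ 64 * Real.pi ^ 2 * (C : ℝ) ^ 2 *
      (bracket n₁ ^ (2 * k) * bracket n₂ ^ (2 * k)) *
        bracket ((n : ℝ) ^ 3 + (n₁ : ℝ) ^ 2 - (n₂ : ℝ) ^ 2) := by
  obtain ⟨u₁, h₁, h₁'⟩ := exists_fourierL2_eq_indicator n₁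
  obtain ⟨u₂, h₂, h₂'⟩ := exists_fourierL2_eq_indicator n₂
  have hpi := Real.pi_pos
  set N : ℝ := (n : ℝ) ^ 3 + (n₁ : ℝ) ^ 2 - (n₂ : ℝ) ^ 2 with hN
  have hP : ∀ (x : ℤ) (a : ℝ), 0 < bracket x ^ a := fun x a =>
    Real.rpow_pos_of_pos (bracket_pos _) _
  set c : ℝ := (n : ℝ) ^ 2 * bracket n ^ (2 * s) * (2 * bracket N)⁻¹ * ((2 * Real.pi)⁻¹) ^ 2 with hc
  have hc0 : 0 ≤ c := by
    have := hP n (2 * s); have := bracket_pos N; positivity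
  set J := Set.Icc ((n₂ : ℝ) ^ 2 - (n₁ : ℝ) ^ 2 - 1) ((n₂ : ℝ) ^ 2 - (n₁ : ℝ) ^ 2 + 1) with hJ
  have hprod : ∀ τ ∈ J, (2 * Real.pi)⁻¹ ≤ ‖fourierL1 (mulConj u₁ u₂) n τ‖ := fun τ hτ => by
    -- a single spatial frequency contributes to the correlation
    have hsingle : ∑' m : ℤ, ∫ σ : ℝ, fourierL2 u₁ m σ * conj (fourierL2 u₂ (m - n) (σ - τ)) =
        ∫ σ : ℝ, fourierL2 u₁ n₁ σ * conj (fourierL2 u₂ n₂ (σ - τ)) := by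
      rw [tsum_eq_single n₁ fun m hm => ?_, show n₁ - n = n₂ by omega]
      refine integral_eq_zero_of_ae ?_
      filter_upwards [h₁' m hm] with σ hσ
      simp [hσ]
    have h₂s :=
      (measurePreserving_sub_right (volume : Measure ℝ) τ).quasiMeasurePreserving.ae_eq_comp h₂
    have hint : ∫ σ : ℝ, fourierL2 u₁ n₁ σ * conj (fourierL2 u₂ n₂ (σ - τ)) =
        ∫ σ : ℝ, (Set.Icc (max (-(n₁ : ℝ) ^ 2 - 1) (-(n₂ : ℝ) ^ 2 - 1 + τ))
          (min (-(n₁ : ℝ) ^ 2 + 1) (-(n₂ : ℝ) ^ 2 + 1 + τ))).indicator (fun _ => (1 : ℂ)) σ := by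
      refine integral_congr_ae ?_
      filter_upwards [h₁, h₂s] with σ e₁ e₂
      simp only [Function.comp_apply] at e₂
      rw [e₁, e₂]
      simp only [Set.indicator_apply, Set.mem_Icc, Pi.one_apply, max_le_iff, le_min_iff,
        le_sub_iff_add_le, sub_le_iff_le_add]
      split_ifs <;> first | (simp; done) | (exfalso; tauto)
    rw [fourierL1_mulConj, hsingle, hint, integral_indicator_const _ measurableSet_Icc]
    rw [hJ, Set.mem_Icc] at hτ
    rw [norm_mul, Measure.real, Real.volume_Icc, norm_smul, norm_one, mul_one, norm_inv]
    -- the two intervals of length two are offset by at most one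
    have hl : 1 ≤ min (-(n₁ : ℝ) ^ 2 + 1) (-(n₂ : ℝ) ^ 2 + 1 + τ) -
        max (-(n₁ : ℝ) ^ 2 - 1) (-(n₂ : ℝ) ^ 2 - 1 + τ) := by
      rcases min_cases (-(n₁ : ℝ) ^ 2 + 1) (-(n₂ : ℝ) ^ 2 + 1 + τ) with h | h <;>
      rcases max_cases (-(n₁ : ℝ) ^ 2 - 1) (-(n₂ : ℝ) ^ 2 - 1 + τ) with h' | h' <;>
      linarith [h.1, h'.1, h.2, h'.2, hτ.1, hτ.2]
    rw [ENNReal.toReal_ofReal (by linarith), Real.norm_of_nonneg (by linarith)]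
    have : ‖(2 * Real.pi : ℂ)‖ = 2 * Real.pi := by simp [abs_of_pos hpi]
    rw [this]
    exact le_mul_of_one_le_right (by positivity) hl
  have hY : ENNReal.ofReal (2 * c) ≤ normY s (-1 / 2) (fourierDx (mulConj u₁ u₂)) ^ 2 := by
    rw [normY_sq]
    refine le_trans ?_ (ENNReal.le_tsum n)
    calc ENNReal.ofReal (2 * c) = ∫⁻ τ : ℝ, J.indicator (fun _ => ENNReal.ofReal c) τ := by
          rw [lintegral_indicator_const measurableSet_Icc, Real.volume_Icc,
            ← ENNReal.ofReal_mul hc0]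
          congr 1; ring
      _ ≤ _ := by
          refine lintegral_mono fun τ => ?_
          by_cases hτ : τ ∈ J
          swap
          · rw [Set.indicator_of_notMem hτ]
            exact zero_le
          rw [Set.indicator_of_mem hτ, ← ofReal_norm, ← ENNReal.ofReal_pow (norm_nonneg _),
            ← ENNReal.ofReal_mul
              (mul_pos (hP n (2 * s)) (Real.rpow_pos_of_pos (bracket_pos _) _)).le]
          refine ENNReal.ofReal_le_ofReal ?_
          have hf : ‖fourierDx (mulConj u₁ u₂) n τ‖ ^ 2 =
              (n : ℝ) ^ 2 * ‖fourierL1 (mulConj u₁ u₂) n τ‖ ^ 2 := by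
            rw [fourierDx, norm_mul, norm_mul, Complex.norm_I, one_mul, Complex.norm_intCast,
              mul_pow, sq_abs]
          have hb : bracket (τ - (n : ℝ) ^ 3) ≤ 2 * bracket N := by
            rw [hJ, Set.mem_Icc] at hτ
            have : |τ - (n : ℝ) ^ 3| ≤ 1 + |N| := by
              rw [abs_le, hN]
              have := neg_abs_le N; have := le_abs_self N
              constructor <;> linarith [hτ.1, hτ.2]
            simp only [bracket]; linarith [abs_nonneg N]
          rw [hf, show (2 * (-1 / 2) : ℝ) = -1 by norm_num, Real.rpow_neg_one]
          have e1 : (2 * bracket N)⁻¹ ≤ (bracket (τ - (n : ℝ) ^ 3))⁻¹ :=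
            inv_anti₀ (bracket_pos _) hb
          have e2 := pow_le_pow_left₀ (by positivity) (hprod τ hτ) 2
          have e3 := hP n (2 * s)
          have e4 := bracket_pos N
          calc c = bracket n ^ (2 * s) * (2 * bracket N)⁻¹ *
                ((n : ℝ) ^ 2 * ((2 * Real.pi)⁻¹) ^ 2) := by
                rw [hc]; ring
            _ ≤ bracket n ^ (2 * s) * (bracket (τ - (n : ℝ) ^ 3))⁻¹ *
                ((n : ℝ) ^ 2 * ‖fourierL1 (mulConj u₁ u₂) n τ‖ ^ 2) := by
              have := inv_pos.2 (bracket_pos (τ - (n : ℝ) ^ 3))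
              gcongr
  have hX₁ := normX_sq_le_of_indicator (k := k) h₁ h₁'
  have hX₂ := normX_sq_le_of_indicator (k := k) h₂ h₂'
  have hfin := hY.trans (pow_le_pow_left₀ zero_le (hC u₁ u₂) 2)
  rw [mul_pow, mul_pow] at hfin
  have hfin2 : ENNReal.ofReal (2 * c) ≤ ENNReal.ofReal
      ((C : ℝ) ^ 2 * ((4 * bracket n₁ ^ (2 * k)) * (4 * bracket n₂ ^ (2 * k)))) := by
    refine hfin.trans ?_
    have a1 := hP n₁ (2 * k); have a2 := hP n₂ (2 * k)
    rw [ENNReal.ofReal_mul (by positivity), ENNReal.ofReal_mul (by positivity),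
      ENNReal.ofReal_pow (by positivity), ENNReal.ofReal_coe_nnreal]
    gcongr
  have a1 := hP n₁ (2 * k); have a2 := hP n₂ (2 * k)
  rw [ENNReal.ofReal_le_ofReal_iff (by positivity)] at hfin2
  have hbN := bracket_pos N
  have : (n : ℝ) ^ 2 * bracket n ^ (2 * s) = 2 * c * (4 * Real.pi ^ 2 * bracket N) := by
    rw [hc]; field_simp; ring
  rw [this]
  calc _ ≤ _ := mul_le_mul_of_nonneg_right hfin2 (by positivity)
    _ = _ := by ring

/-! ### Necessity of the conditions -/

theorem rpow_le_four_rpow_abs_mul {x y : ℝ} (hy : 0 < y) (h₁ : y ≤ x) (h₂ : x ≤ 4 * y) (a : ℝ) :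
    x ^ a ≤ 4 ^ |a| * y ^ a := by
  have h : 1 ≤ x / y := (one_le_div hy).2 h₁
  rw [← div_mul_cancel₀ x hy.ne', Real.mul_rpow (by linarith) hy.le]
  gcongr
  exact (Real.rpow_le_rpow_of_exponent_le h (le_abs_self a)).trans
    (Real.rpow_le_rpow (by linarith) ((div_le_iff₀ hy).2 h₂) (abs_nonneg a))

theorem rpow_le_four_rpow_abs_mul' {x y : ℝ} (hy : 0 < y) (h₁ : y ≤ x) (h₂ : x ≤ 4 * y) (a : ℝ) :
    y ^ a ≤ 4 ^ |a| * x ^ a := by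
  have h := rpow_le_four_rpow_abs_mul hy h₁ h₂ (-a)
  have hx : 0 < x := hy.trans_le h₁
  rw [abs_neg, Real.rpow_neg hx.le, Real.rpow_neg hy.le, ← div_eq_mul_inv,
    le_div_iff₀ (Real.rpow_pos_of_pos hy _), inv_mul_le_iff₀ (Real.rpow_pos_of_pos hx _)] at h
  linarith

/-- Bounded powers of the positive integers have a nonpositive exponent. -/
theorem nonpos_of_natCast_rpow_le {a D : ℝ} (h : ∀ l : ℕ, 1 ≤ l → (l : ℝ) ^ a ≤ D) : a ≤ 0 := by
  by_contra! ha
  obtain ⟨l, hl1, hl2⟩ := ((Filter.eventually_ge_atTop 1).and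
    (((tendsto_rpow_atTop ha).comp tendsto_natCast_atTop_atTop).eventually_gt_atTop D)).exists
  exact absurd (h l hl1) (not_le.2 hl2)

/-- The frequencies `l - 2l²` and `-l - 2l²` are exactly resonant with the output `2l`, which is
much smaller: the derivative costs `l^{1+s}`, the two input weights give back `l^{4k}`. -/
theorem EstimateY.one_add_le {k s : ℝ} {C : ℝ≥0} (hC : EstimateY k s C) : 1 + s ≤ 4 * k := by
  have key : 2 + 2 * s - 8 * k ≤ 0 := by
    refine nonpos_of_natCast_rpow_le
      (D := 4 ^ |2 * s| * (64 * Real.pi ^ 2 * (C : ℝ) ^ 2 * (4 ^ |2 * k| * 4 ^ |2 * k|)))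
      fun l hl => ?_
    have h1 : (1 : ℝ) ≤ l := by exact_mod_cast hl
    have h0 : (0 : ℝ) < l := by linarith
    have h := hC.le_mul (l - 2 * l ^ 2) (-l - 2 * l ^ 2) (2 * l) (by ring)
    push_cast at h
    have hN : bracket ((2 * (l : ℝ)) ^ 3 + (l - 2 * (l : ℝ) ^ 2) ^ 2 -
        (-l - 2 * (l : ℝ) ^ 2) ^ 2) = 1 := by
      rw [bracket, show (2 * (l : ℝ)) ^ 3 + (l - 2 * (l : ℝ) ^ 2) ^ 2 -
        (-l - 2 * (l : ℝ) ^ 2) ^ 2 = 0 by ring]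
      simp
    have b1 : bracket ((l : ℝ) - 2 * (l : ℝ) ^ 2) = 1 - l + 2 * (l : ℝ) ^ 2 := by
      rw [bracket, abs_of_nonpos (by nlinarith)]; ring
    have b2 : bracket (-(l : ℝ) - 2 * (l : ℝ) ^ 2) = 1 + l + 2 * (l : ℝ) ^ 2 := by
      rw [bracket, abs_of_nonpos (by nlinarith)]; ring
    have b3 : bracket (2 * (l : ℝ)) = 1 + 2 * l := by
      rw [bracket, abs_of_nonneg (by positivity)]
    have hl2 : (0 : ℝ) < (l : ℝ) ^ 2 := by positivity
    have c1 := rpow_le_four_rpow_abs_mul (x := 1 - l + 2 * (l : ℝ) ^ 2) hl2 (by nlinarith)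
      (by nlinarith) (2 * k)
    have c2 := rpow_le_four_rpow_abs_mul (x := 1 + l + 2 * (l : ℝ) ^ 2) hl2 (by nlinarith)
      (by nlinarith) (2 * k)
    have c3 := rpow_le_four_rpow_abs_mul' (x := 1 + 2 * (l : ℝ)) h0 (by linarith)
      (by linarith) (2 * s)
    rw [hN, b1, b2, b3, mul_one] at h
    have e1 : ((l : ℝ) ^ 2) ^ (2 * k) * ((l : ℝ) ^ 2) ^ (2 * k) = (l : ℝ) ^ (8 * k) := by
      rw [← Real.rpow_natCast, ← Real.rpow_mul h0.le, ← Real.rpow_add h0]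
      congr 1; push_cast; ring
    have e2 : (l : ℝ) ^ (2 + 2 * s - 8 * k) =
        (l : ℝ) ^ 2 * (l : ℝ) ^ (2 * s) / (l : ℝ) ^ (8 * k) := by
      rw [Real.rpow_sub h0, Real.rpow_add h0, Real.rpow_two]
    rw [e2, div_le_iff₀ (Real.rpow_pos_of_pos h0 _), ← e1]
    have p1 : 0 < (1 - l + 2 * (l : ℝ) ^ 2) := by nlinarith
    calc (l : ℝ) ^ 2 * (l : ℝ) ^ (2 * s) ≤
          (l : ℝ) ^ 2 * (4 ^ |2 * s| * (1 + 2 * (l : ℝ)) ^ (2 * s)) := by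
          gcongr
      _ ≤ 4 ^ |2 * s| * ((2 * (l : ℝ)) ^ 2 * (1 + 2 * (l : ℝ)) ^ (2 * s)) := by
          have : (0 : ℝ) ≤ 4 ^ |2 * s| * (1 + 2 * (l : ℝ)) ^ (2 * s) := by positivity
          nlinarith
      _ ≤ 4 ^ |2 * s| * (64 * Real.pi ^ 2 * (C : ℝ) ^ 2 *
          ((4 ^ |2 * k| * ((l : ℝ) ^ 2) ^ (2 * k)) * (4 ^ |2 * k| * ((l : ℝ) ^ 2) ^ (2 * k)))) := by
          refine mul_le_mul_of_nonneg_left (h.trans ?_) (by positivity)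
          gcongr
      _ = _ := by ring
  linarith

/-- The frequencies `l` and `0` have output frequency `l` and output modulation of size `l³`: the
estimate compares `l^{1+s-3/2}` with `l^k`. -/
theorem EstimateY.neg_half_le {k s : ℝ} {C : ℝ≥0} (hC : EstimateY k s C) : -(1 / 2) ≤ k - s := by
  have key : 2 * s - 2 * k - 1 ≤ 0 := by
    refine nonpos_of_natCast_rpow_le
      (D := 4 ^ |2 * s| * (64 * Real.pi ^ 2 * (C : ℝ) ^ 2 * 4 ^ |2 * k| * 3))
      fun l hl => ?_
    have h1 : (1 : ℝ) ≤ l := by exact_mod_cast hl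
    have h0 : (0 : ℝ) < l := by linarith
    have h := hC.le_mul l 0 l (by ring)
    push_cast at h
    have hN : bracket ((l : ℝ) ^ 3 + (l : ℝ) ^ 2 - 0 ^ 2) ≤ 3 * (l : ℝ) ^ 3 := by
      rw [zero_pow two_ne_zero, sub_zero, bracket, abs_of_nonneg (by positivity)]
      nlinarith [sq_nonneg (l : ℝ), pow_le_pow_right₀ h1 (show 2 ≤ 3 by norm_num),
        one_le_pow₀ h1 (n := 3)]
    have b1 : bracket (0 : ℝ) = 1 := by simp [bracket]
    have b3 : bracket (l : ℝ) = 1 + l := by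
      rw [bracket, abs_of_nonneg (by positivity)]
    have c1 := rpow_le_four_rpow_abs_mul (x := 1 + (l : ℝ)) h0 (by linarith)
      (by linarith) (2 * k)
    have c3 := rpow_le_four_rpow_abs_mul' (x := 1 + (l : ℝ)) h0 (by linarith)
      (by linarith) (2 * s)
    rw [b1, b3, Real.one_rpow, mul_one] at h
    have e2 : (l : ℝ) ^ (2 * s - 2 * k - 1) * ((l : ℝ) ^ 3 * (l : ℝ) ^ (2 * k)) =
        (l : ℝ) ^ 2 * (l : ℝ) ^ (2 * s) := by
      rw [← Real.rpow_natCast, ← Real.rpow_natCast, ← Real.rpow_add h0, ← Real.rpow_add h0,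
        ← Real.rpow_add h0]
      congr 1; push_cast; ring
    have p : 0 < (l : ℝ) ^ 3 * (l : ℝ) ^ (2 * k) := by positivity
    rw [← mul_le_mul_iff_left₀ p, e2]
    calc (l : ℝ) ^ 2 * (l : ℝ) ^ (2 * s) ≤
          (l : ℝ) ^ 2 * (4 ^ |2 * s| * (1 + (l : ℝ)) ^ (2 * s)) := by
          gcongr
      _ = 4 ^ |2 * s| * ((l : ℝ) ^ 2 * (1 + (l : ℝ)) ^ (2 * s)) := by ring
      _ ≤ 4 ^ |2 * s| * (64 * Real.pi ^ 2 * (C : ℝ) ^ 2 *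
          (4 ^ |2 * k| * (l : ℝ) ^ (2 * k)) * (3 * (l : ℝ) ^ 3)) := by
          refine mul_le_mul_of_nonneg_left (h.trans ?_) (by positivity)
          gcongr
          exact (bracket_pos _).le
      _ = _ := by ring
  linarith

theorem normX_mono {k b b' : ℝ} (h : b ≤ b') (F : ℤ → ℝ → ℂ) : normX k b F ≤ normX k b' F := by
  unfold normX
  gcongr
  · exact (Real.rpow_pos_of_pos (bracket_pos _) _).le
  · exact one_le_bracket _

theorem EstimateW.estimateY {k s ε : ℝ} (hε : 0 < ε) {C : ℝ≥0} (h : EstimateW k s ε C) :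
    EstimateY k s (2 * C) := fun u₁ u₂ => by
  have hm : ∀ u : L2, normX k (1 / 2 - ε) (fourierL2 u) ≤ normX k (1 / 2) (fourierL2 u) :=
    fun u => normX_mono (by linarith) _
  calc normY s (-1 / 2) (fourierDx (mulConj u₁ u₂)) ≤ normW s (fourierDx (mulConj u₁ u₂)) :=
        le_self_add
    _ ≤ _ := h u₁ u₂
    _ ≤ C * (normX k (1 / 2) (fourierL2 u₁) * normX k (1 / 2) (fourierL2 u₂) +
        normX k (1 / 2) (fourierL2 u₁) * normX k (1 / 2) (fourierL2 u₂)) := by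
        gcongr <;> exact hm _
    _ = _ := by push_cast; ring

theorem EstimateW.mono {k s ε ε₀ : ℝ} (hε : ε ≤ ε₀) {C : ℝ≥0} (h : EstimateW k s ε₀ C) :
    EstimateW k s ε C := fun u₁ u₂ => by
  have hm : ∀ u : L2, normX k (1 / 2 - ε₀) (fourierL2 u) ≤ normX k (1 / 2 - ε) (fourierL2 u) :=
    fun u => normX_mono (by linarith) _
  refine (h u₁ u₂).trans ?_
  gcongr <;> exact hm _

/-! ### Integrals and sums of brackets -/

theorem bracket_rpow_pos (y a : ℝ) : 0 < bracket y ^ a := Real.rpow_pos_of_pos (bracket_pos y) a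

theorem bracket_rpow_neg_le_one (y : ℝ) {a : ℝ} (ha : 0 ≤ a) : bracket y ^ (-a) ≤ 1 :=
  Real.rpow_le_one_of_one_le_of_nonpos (one_le_bracket y) (by linarith)

theorem bracket_neg (y : ℝ) : bracket (-y) = bracket y := by simp [bracket]

theorem measurable_bracket : Measurable bracket := by unfold bracket; fun_prop

theorem bracket_add_le (x y : ℝ) : bracket (x + y) ≤ bracket x + bracket y := by
  simp only [bracket]; linarith [abs_add_le x y]

theorem bracket_add_le_mul (x y : ℝ) : bracket (x + y) ≤ bracket x * bracket y := by
  simp only [bracket]; nlinarith [abs_add_le x y, abs_nonneg x, abs_nonneg y,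
    mul_nonneg (abs_nonneg x) (abs_nonneg y)]

/-- A product of negative powers is at most the sum of the powers with the total exponent. -/
theorem rpow_neg_mul_rpow_neg_le {x y a b : ℝ} (hx : 0 < x) (hy : 0 < y) (ha : 0 ≤ a) (hb : 0 ≤ b) :
    x ^ (-a) * y ^ (-b) ≤ x ^ (-(a + b)) + y ^ (-(a + b)) := by
  have h1 : x ^ (-(a + b)) = x ^ (-a) * x ^ (-b) := by rw [← Real.rpow_add hx]; ring_nf
  have h2 : y ^ (-(a + b)) = y ^ (-a) * y ^ (-b) := by rw [← Real.rpow_add hy]; ring_nf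
  rcases le_total x y with h | h
  · have : y ^ (-b) ≤ x ^ (-b) := Real.rpow_le_rpow_of_nonpos hx h (by linarith)
    calc _ ≤ x ^ (-a) * x ^ (-b) := by gcongr
      _ ≤ _ := by rw [h1]; linarith [Real.rpow_pos_of_pos hy (-(a + b))]
  · have : x ^ (-a) ≤ y ^ (-a) := Real.rpow_le_rpow_of_nonpos hy h (by linarith)
    calc _ ≤ y ^ (-a) * y ^ (-b) := by gcongr
      _ ≤ _ := by rw [h2]; linarith [Real.rpow_pos_of_pos hx (-(a + b))]

theorem lintegral_bracket_rpow_lt_top {r : ℝ} (hr : 1 < r) :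
    ∫⁻ x : ℝ, ENNReal.ofReal (bracket x ^ (-r)) < ∞ := by
  have h : Integrable (fun x : ℝ => (1 + ‖x‖) ^ (-r)) volume :=
    integrable_one_add_norm (by simpa using hr)
  exact h.lintegral_lt_top

/-- The larger of the two brackets is at least half of `⟨x - y⟩`; this trades the power `γ` for
decay in `x - y`. -/
theorem bracket_mul_bracket_rpow_le {β γ : ℝ} (hγ : 0 ≤ γ) (hγβ : γ ≤ β) (x y : ℝ) :
    bracket x ^ (-β) * bracket y ^ (-β) ≤ 2 ^ γ * bracket (x - y) ^ (-γ) *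
      (bracket x ^ (-(2 * β - γ)) + bracket y ^ (-(2 * β - γ))) := by
  wlog h : bracket x ≤ bracket y generalizing x y
  · have := this y x (le_of_not_ge h)
    rw [← bracket_neg (x - y), neg_sub]
    linarith
  have hx := bracket_pos x
  have hy := bracket_pos y
  have h1 : bracket (x - y) ≤ 2 * bracket y := by
    rw [sub_eq_add_neg]
    linarith [bracket_add_le x (-y), bracket_neg y]
  have h2 : bracket y ^ (-β) ≤ bracket x ^ (-(β - γ)) * (2 ^ γ * bracket (x - y) ^ (-γ)) := by
    have e : bracket y ^ (-β) = bracket y ^ (-(β - γ)) * bracket y ^ (-γ) := by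
      rw [← Real.rpow_add hy]; ring_nf
    rw [e]
    have e2 : (2 : ℝ) ^ γ * bracket (x - y) ^ (-γ) = (bracket (x - y) / 2) ^ (-γ) := by
      rw [Real.div_rpow (bracket_pos _).le (by norm_num), Real.rpow_neg (by norm_num : (0:ℝ) ≤ 2)]
      field_simp
    rw [e2]
    have f1 : bracket y ^ (-(β - γ)) ≤ bracket x ^ (-(β - γ)) :=
      Real.rpow_le_rpow_of_nonpos hx h (by linarith)
    have f2 : bracket y ^ (-γ) ≤ (bracket (x - y) / 2) ^ (-γ) :=
      Real.rpow_le_rpow_of_nonpos (by linarith [bracket_pos (x - y)]) (by linarith) (by linarith)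
    have := bracket_rpow_pos x (-(β - γ)); have := bracket_rpow_pos y (-γ)
    gcongr
  have e3 : bracket x ^ (-(2 * β - γ)) = bracket x ^ (-β) * bracket x ^ (-(β - γ)) := by
    rw [← Real.rpow_add hx]; ring_nf
  have p1 := bracket_rpow_pos x (-β); have p2 := bracket_rpow_pos y (-(2 * β - γ))
  have p3 := bracket_rpow_pos (x - y) (-γ)
  have p4 : (0 : ℝ) < 2 ^ γ := by positivity
  calc _ ≤ bracket x ^ (-β) * (bracket x ^ (-(β - γ)) * (2 ^ γ * bracket (x - y) ^ (-γ))) := by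
        gcongr
    _ = 2 ^ γ * bracket (x - y) ^ (-γ) * bracket x ^ (-(2 * β - γ)) := by rw [e3]; ring
    _ ≤ _ := by gcongr; linarith

theorem exists_lintegral_bracket_mul_le {β γ : ℝ} (hγ : 0 ≤ γ) (hγβ : γ ≤ β) (h : 1 < 2 * β - γ) :
    ∃ C : ℝ≥0, ∀ a b : ℝ, ∫⁻ x : ℝ,
      ENNReal.ofReal (bracket (x + a) ^ (-β) * bracket (x + b) ^ (-β)) ≤
        C * ENNReal.ofReal (bracket (a - b) ^ (-γ)) := by
  set I := ∫⁻ x : ℝ, ENNReal.ofReal (bracket x ^ (-(2 * β - γ))) with hI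
  have hIfin : I < ∞ := lintegral_bracket_rpow_lt_top h
  refine ⟨(ENNReal.ofReal (2 ^ γ) * (I + I)).toNNReal, fun a b => ?_⟩
  rw [ENNReal.coe_toNNReal (ENNReal.mul_lt_top ENNReal.ofReal_lt_top
    (ENNReal.add_lt_top.2 ⟨hIfin, hIfin⟩)).ne]
  have hm : ∀ c : ℝ, Measurable fun x : ℝ => ENNReal.ofReal (bracket (x + c) ^ (-(2 * β - γ))) :=
    fun c => ((measurable_bracket.comp (measurable_id.add_const c)).pow_const _).ennreal_ofReal
  calc _ ≤ ∫⁻ x : ℝ, ENNReal.ofReal (2 ^ γ * bracket (a - b) ^ (-γ)) *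
        (ENNReal.ofReal (bracket (x + a) ^ (-(2 * β - γ))) +
          ENNReal.ofReal (bracket (x + b) ^ (-(2 * β - γ)))) := by
        refine lintegral_mono fun x => ?_
        rw [← ENNReal.ofReal_add (bracket_rpow_pos _ _).le (bracket_rpow_pos _ _).le,
          ← ENNReal.ofReal_mul (mul_nonneg (by positivity) (bracket_rpow_pos _ _).le)]
        refine ENNReal.ofReal_le_ofReal ?_
        have := bracket_mul_bracket_rpow_le hγ hγβ (x + a) (x + b)
        rwa [add_sub_add_left_eq_sub] at this
    _ = ENNReal.ofReal (2 ^ γ * bracket (a - b) ^ (-γ)) * (I + I) := by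
        rw [lintegral_const_mul' _ _ ENNReal.ofReal_ne_top, lintegral_add_left (hm a),
          lintegral_add_right_eq_self (fun x : ℝ => ENNReal.ofReal (bracket x ^ (-(2 * β - γ)))) a,
          lintegral_add_right_eq_self (fun x : ℝ => ENNReal.ofReal (bracket x ^ (-(2 * β - γ)))) b]
    _ = _ := by
        rw [ENNReal.ofReal_mul (by positivity)]; ring

theorem exists_tsum_bracket_rpow_le {r : ℝ} (hr : 1 < r) :
    ∃ C : ℝ≥0, ∀ c : ℝ, ∑' n : ℤ, ENNReal.ofReal (bracket (n + c) ^ (-r)) ≤ C := by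
  have hs : Summable fun n : ℤ => bracket (n : ℝ) ^ (-r) := by
    refine Summable.of_norm_bounded_eventually (g := fun n : ℤ => |(n : ℝ)| ^ (-r))
      (Real.summable_abs_int_rpow hr) ?_
    filter_upwards [(Set.finite_singleton (0 : ℤ)).compl_mem_cofinite] with n hn
    have hn' : 0 < |(n : ℝ)| := abs_pos.2 (by exact_mod_cast hn)
    rw [Real.norm_of_nonneg (bracket_rpow_pos _ _).le]
    exact Real.rpow_le_rpow_of_nonpos hn' (by simp [bracket]) (by linarith)
  have hfin : ∑' n : ℤ, ENNReal.ofReal (bracket (n : ℝ) ^ (-r)) < ∞ := hs.tsum_ofReal_lt_top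
  -- the integer part of `c` does not matter, and its fractional part costs a factor `2`
  refine ⟨(ENNReal.ofReal (2 ^ r) * ∑' n : ℤ, ENNReal.ofReal (bracket (n : ℝ) ^ (-r))).toNNReal,
    fun c => ?_⟩
  rw [ENNReal.coe_toNNReal (ENNReal.mul_lt_top ENNReal.ofReal_lt_top hfin).ne,
    ← ENNReal.tsum_mul_left, ← (Equiv.addRight ⌊c⌋).tsum_eq
      fun n : ℤ => ENNReal.ofReal (2 ^ r) * ENNReal.ofReal (bracket (n : ℝ) ^ (-r))]
  refine ENNReal.tsum_le_tsum fun n => ?_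
  rw [← ENNReal.ofReal_mul (by positivity)]
  refine ENNReal.ofReal_le_ofReal ?_
  have h1 : bracket ((Equiv.addRight ⌊c⌋ n : ℤ) : ℝ) / 2 ≤ bracket (n + c) := by
    have h2 : ((Equiv.addRight ⌊c⌋ n : ℤ) : ℝ) = (n + c) + -(Int.fract c) := by
      rw [Equiv.coe_addRight, Int.cast_add, Int.fract]; ring
    rw [h2]
    refine (div_le_iff₀ two_pos).2 ((bracket_add_le_mul _ _).trans ?_)
    refine mul_le_mul_of_nonneg_left ?_ (bracket_pos _).le
    rw [bracket_neg, bracket, abs_of_nonneg (Int.fract_nonneg c)]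
    linarith [Int.fract_lt_one c]
  calc bracket (n + c) ^ (-r) ≤ (bracket ((Equiv.addRight ⌊c⌋ n : ℤ) : ℝ) / 2) ^ (-r) :=
        Real.rpow_le_rpow_of_nonpos (by linarith [bracket_pos ((Equiv.addRight ⌊c⌋ n : ℤ) : ℝ)]) h1
          (by linarith)
    _ = _ := by
      rw [Real.div_rpow (bracket_pos _).le (by norm_num), Real.rpow_neg (by norm_num : (0:ℝ) ≤ 2)]
      field_simp

/-- Uniform summability of a product of brackets along two arithmetic progressions. By the bound
`rpow_neg_mul_rpow_neg_le` only the total exponent matters. -/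
theorem exists_tsum_bracket_mul_le {κ γ : ℝ} (hκ : 0 ≤ κ) (hγ : 0 ≤ γ) (h : 1 < κ + γ) :
    ∃ C : ℝ≥0, ∀ a b c : ℝ, 1 ≤ |b| → ∑' n : ℤ,
      ENNReal.ofReal (bracket (n + c) ^ (-κ) * bracket (b * n + a) ^ (-γ)) ≤ C := by
  obtain ⟨C, hC⟩ := exists_tsum_bracket_rpow_le h
  refine ⟨C + C, fun a b c hb => ?_⟩
  rw [ENNReal.coe_add]
  refine le_trans ?_ (add_le_add (hC c) (hC (a / b)))
  rw [← ENNReal.tsum_add]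
  refine ENNReal.tsum_le_tsum fun n => ?_
  rw [← ENNReal.ofReal_add (bracket_rpow_pos _ _).le (bracket_rpow_pos _ _).le]
  refine ENNReal.ofReal_le_ofReal ((rpow_neg_mul_rpow_neg_le (bracket_pos _) (bracket_pos _)
    hκ hγ).trans ?_)
  gcongr 1
  refine Real.rpow_le_rpow_of_nonpos (bracket_pos _) ?_ (by linarith)
  have hb0 : b ≠ 0 := by rintro rfl; simp at hb; linarith
  have : b * n + a = b * (n + a / b) := by field_simp
  rw [this, bracket, bracket, abs_mul]
  nlinarith [abs_nonneg ((n : ℝ) + a / b)]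

theorem exists_cubic_eq_prod (p q r : ℝ) : ∃ z₁ z₂ z₃ : ℂ, ∀ x : ℂ,
    x ^ 3 + p * x ^ 2 + q * x + r = (x - z₁) * (x - z₂) * (x - z₃) := by
  open Polynomial in
  set P : ℂ[X] := X ^ 3 + C (p : ℂ) * X ^ 2 + C (q : ℂ) * X + C (r : ℂ) with hP
  have hdeg : P.natDegree = 3 := by rw [hP]; compute_degree!
  have hmon : P.Monic := by rw [hP]; monicity!
  have hs := IsAlgClosed.splits P
  have hcard : Multiset.card P.roots = 3 := by rw [← hdeg]; exact hs.natDegree_eq_card_roots.symm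
  obtain ⟨z₁, z₂, z₃, hz⟩ := Multiset.card_eq_three.1 hcard
  refine ⟨z₁, z₂, z₃, fun x => ?_⟩
  have h1 : P.eval x = ((P.roots.map fun a => Polynomial.X - Polynomial.C a).prod).eval x := by
    rw [← hs.eq_prod_roots_of_monic hmon]
  rw [hz] at h1
  simpa [hP, mul_assoc] using h1

/-- The values of a monic cubic at the integers are spread out like the cubes, uniformly in the
lower-order coefficients: a value is at least the cube of the distance to the nearest root. -/
theorem exists_tsum_bracket_cubic_le {γ : ℝ} (hγ : 1 < 3 * γ) :
    ∃ C : ℝ≥0, ∀ p q r : ℝ, ∑' n : ℤ,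
      ENNReal.ofReal (bracket ((n : ℝ) ^ 3 + p * n ^ 2 + q * n + r) ^ (-γ)) ≤ C := by
  obtain ⟨C, hC⟩ := exists_tsum_bracket_rpow_le hγ
  refine ⟨(4 ^ γ : ℝ).toNNReal * (C + C + C), fun p q r => ?_⟩
  obtain ⟨z₁, z₂, z₃, hz⟩ := exists_cubic_eq_prod p q r
  have key : ∀ n : ℤ, bracket ((n : ℝ) ^ 3 + p * n ^ 2 + q * n + r) ^ (-γ) ≤
      4 ^ γ * (bracket (n + -z₁.re) ^ (-(3 * γ)) + bracket (n + -z₂.re) ^ (-(3 * γ)) +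
        bracket (n + -z₃.re) ^ (-(3 * γ))) := fun n => by
    have hre : ∀ z : ℂ, |(n : ℝ) + -z.re| ≤ ‖(n : ℂ) - z‖ := fun z => by
      simpa [sub_eq_add_neg] using Complex.abs_re_le_norm ((n : ℂ) - z)
    have hprod : |(n : ℝ) ^ 3 + p * n ^ 2 + q * n + r| =
        ‖(n : ℂ) - z₁‖ * ‖(n : ℂ) - z₂‖ * ‖(n : ℂ) - z₃‖ := by
      rw [← norm_mul, ← norm_mul, ← hz, ← Real.norm_eq_abs, ← Complex.norm_real]
      push_cast
      rfl
    have hlow : ∀ y : ℝ, |y| ≤ ‖(n : ℂ) - z₁‖ → |y| ≤ ‖(n : ℂ) - z₂‖ → |y| ≤ ‖(n : ℂ) - z₃‖ →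
        bracket ((n : ℝ) ^ 3 + p * n ^ 2 + q * n + r) ^ (-γ) ≤ 4 ^ γ * bracket y ^ (-(3 * γ)) := by
      intro y h1 h2 h3
      have h4 : |y| ^ 3 ≤ |(n : ℝ) ^ 3 + p * n ^ 2 + q * n + r| := by
        rw [hprod, pow_succ, sq]
        gcongr
      have h5 : bracket y ^ 3 / 4 ≤ bracket ((n : ℝ) ^ 3 + p * n ^ 2 + q * n + r) := by
        rw [bracket, bracket]
        nlinarith [abs_nonneg y, sq_nonneg (|y| - 1),
          mul_nonneg (abs_nonneg y) (sq_nonneg (|y| - 1))]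
      refine (Real.rpow_le_rpow_of_nonpos (by have := bracket_pos y; positivity) h5
        (by linarith)).trans (le_of_eq ?_)
      rw [Real.div_rpow (by have := bracket_pos y; positivity) (by norm_num),
        Real.rpow_neg (by norm_num : (0:ℝ) ≤ 4), ← Real.rpow_natCast,
        ← Real.rpow_mul (bracket_pos y).le]
      push_cast
      rw [mul_neg]
      field_simp
    have p0 : (0 : ℝ) < 4 ^ γ := by positivity
    have p1 := bracket_rpow_pos (n + -z₁.re) (-(3 * γ))
    have p2 := bracket_rpow_pos (n + -z₂.re) (-(3 * γ))
    have p3 := bracket_rpow_pos (n + -z₃.re) (-(3 * γ))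
    have h12 := le_total ‖(n : ℂ) - z₁‖ ‖(n : ℂ) - z₂‖
    have h23 := le_total ‖(n : ℂ) - z₂‖ ‖(n : ℂ) - z₃‖
    have h13 := le_total ‖(n : ℂ) - z₁‖ ‖(n : ℂ) - z₃‖
    have hor : (‖(n : ℂ) - z₁‖ ≤ ‖(n : ℂ) - z₂‖ ∧ ‖(n : ℂ) - z₁‖ ≤ ‖(n : ℂ) - z₃‖) ∨
        (‖(n : ℂ) - z₂‖ ≤ ‖(n : ℂ) - z₁‖ ∧ ‖(n : ℂ) - z₂‖ ≤ ‖(n : ℂ) - z₃‖) ∨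
        (‖(n : ℂ) - z₃‖ ≤ ‖(n : ℂ) - z₁‖ ∧ ‖(n : ℂ) - z₃‖ ≤ ‖(n : ℂ) - z₂‖) := by grind
    rcases hor with ⟨ha, hb⟩ | ⟨ha, hb⟩ | ⟨ha, hb⟩
    · exact (hlow _ (hre z₁) ((hre z₁).trans ha) ((hre z₁).trans hb)).trans (by gcongr; linarith)
    · exact (hlow _ ((hre z₂).trans ha) (hre z₂) ((hre z₂).trans hb)).trans (by gcongr; linarith)
    · exact (hlow _ ((hre z₃).trans ha) ((hre z₃).trans hb) (hre z₃)).trans (by gcongr; linarith)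
  calc _ ≤ ∑' n : ℤ, ENNReal.ofReal (4 ^ γ) * (ENNReal.ofReal (bracket (n + -z₁.re) ^ (-(3 * γ))) +
        ENNReal.ofReal (bracket (n + -z₂.re) ^ (-(3 * γ))) +
        ENNReal.ofReal (bracket (n + -z₃.re) ^ (-(3 * γ)))) := by
        refine ENNReal.tsum_le_tsum fun n => (ENNReal.ofReal_le_ofReal (key n)).trans (le_of_eq ?_)
        have p1 := (bracket_rpow_pos (n + -z₁.re) (-(3 * γ))).le
        have p2 := (bracket_rpow_pos (n + -z₂.re) (-(3 * γ))).le
        have p3 := (bracket_rpow_pos (n + -z₃.re) (-(3 * γ))).le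
        rw [ENNReal.ofReal_mul (by positivity), ENNReal.ofReal_add (by positivity) p3,
          ENNReal.ofReal_add p1 p2]
    _ ≤ _ := by
        rw [ENNReal.tsum_mul_left, ENNReal.tsum_add, ENNReal.tsum_add]
        push_cast
        gcongr
        · exact le_rfl
        · exact hC _
        · exact hC _
        · exact hC _

/-! ### The resonance function and the bound for the multiplier -/

/-- The resonance function: if the output frequency `n` and the two input frequencies `m`, `m - n`
carry the modulations `τ - n³`, `τ₁ + m²` and `τ₂ + (m - n)²` with `τ = τ₁ - τ₂`, then
`(τ₁ + m²) - (τ₂ + (m - n)²) - (τ - n³) = resonance n m`. -/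
def resonance (n m : ℤ) : ℝ := (n : ℝ) ^ 3 + (m : ℝ) ^ 2 - ((m : ℝ) - n) ^ 2

/-- The multiplier left over when half a power of the resonance has been used to compensate for
the derivative: `|n| ⟨n⟩ˢ / (⟨resonance⟩^{1/2} ⟨m⟩ᵏ ⟨m - n⟩ᵏ)`. -/
def weight (k s : ℝ) (n m : ℤ) : ℝ :=
  |(n : ℝ)| * bracket n ^ s * bracket (resonance n m) ^ (-(1 / 2) : ℝ) *
    (bracket m * bracket ((m : ℝ) - n)) ^ (-k)

theorem weight_nonneg (k s : ℝ) (n m : ℤ) : 0 ≤ weight k s n m := by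
  have h1 := bracket_pos n; have h2 := bracket_pos m; have h3 := bracket_pos ((m : ℝ) - n)
  have h4 := bracket_pos (resonance n m)
  unfold weight; positivity

theorem weight_zero_left (k s : ℝ) (m : ℤ) : weight k s 0 m = 0 := by simp [weight]

theorem resonance_eq (n m : ℤ) : resonance n m = 2 * n * (m + ((n : ℝ) ^ 2 - n) / 2) := by
  unfold resonance; ring

theorem bracket_le_bracket_resonance {n : ℤ} (hn : n ≠ 0) (m : ℤ) :
    bracket (m + ((n : ℝ) ^ 2 - n) / 2) ≤ bracket (resonance n m) := by
  have h1 : (1 : ℝ) ≤ |(n : ℝ)| := by exact_mod_cast Int.one_le_abs hn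
  rw [resonance_eq, bracket, bracket, abs_mul, abs_mul, abs_two]
  nlinarith [abs_nonneg ((m : ℝ) + ((n : ℝ) ^ 2 - n) / 2)]

/-- Close to the resonance both input frequencies are at least of size `n²`. -/
theorem bracket_sq_le_of_near {n m : ℝ} (h : |m + (n ^ 2 - n) / 2| ≤ n ^ 2 / 8) :
    bracket n ^ 2 / 16 ≤ bracket m ∧ bracket n ^ 2 / 16 ≤ bracket (m - n) := by
  obtain ⟨h1, h2⟩ := abs_le.1 h
  have hm := neg_abs_le m
  have hmn := neg_abs_le (m - n)
  have hn := le_abs_self n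
  have hn' := neg_abs_le n
  have hsq := sq_abs n
  simp only [bracket]
  constructor <;> nlinarith [sq_nonneg (|n| - 1)]

/-- The multiplier is bounded, and small away from the resonance and from zero input
frequencies. The first regime, close to the resonance, uses `1 + s ≤ 4k`; the second, where the
resonance function has size at least `|n|³`, uses `s - k ≤ 1/2`. -/
theorem weight_sq_le {k s : ℝ} (hk : 0 < k) (h₁ : 1 + s ≤ 4 * k) (h₂ : -(1 / 2) ≤ k - s) (n m : ℤ) :
    weight k s n m ^ 2 ≤ 16 * 256 ^ (2 * k) *
      (bracket (m + ((n : ℝ) ^ 2 - n) / 2) ^ (-min 1 (2 * k)) + bracket m ^ (-min 1 (2 * k)) +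
        bracket (m + -(n : ℝ)) ^ (-min 1 (2 * k))) := by
  set κ := min 1 (2 * k) with hκ
  have hκ1 : κ ≤ 1 := min_le_left _ _
  have hκ2 : κ ≤ 2 * k := min_le_right _ _
  rw [← sub_eq_add_neg]
  set J := bracket (m + ((n : ℝ) ^ 2 - n) / 2) with hJ
  set P := bracket (m : ℝ) with hP
  set Q := bracket ((m : ℝ) - n) with hQ
  set A := bracket (n : ℝ) with hA
  set B := bracket (resonance n m) with hB
  have pJ : 1 ≤ J := one_le_bracket _
  have pP : 1 ≤ P := one_le_bracket _
  have pQ : 1 ≤ Q := one_le_bracket _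
  have pA : 1 ≤ A := one_le_bracket _
  have pB : 1 ≤ B := one_le_bracket _
  have qJ : 0 < J := by linarith
  have qP : 0 < P := by linarith
  have qQ : 0 < Q := by linarith
  have qA : 0 < A := by linarith
  have qB : 0 < B := by linarith
  have hmon : ∀ x : ℝ, 1 ≤ x → ∀ a, κ ≤ a → x ^ (-a) ≤ x ^ (-κ) := fun x hx a ha =>
    Real.rpow_le_rpow_of_exponent_le hx (by linarith)
  rcases eq_or_ne n 0 with rfl | hn
  · rw [weight_zero_left, zero_pow two_ne_zero]
    positivity
  have hnA : (n : ℝ) ^ 2 ≤ A ^ 2 := by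
    rw [← sq_abs (n : ℝ)]
    exact pow_le_pow_left₀ (abs_nonneg _) (by rw [hA, bracket]; linarith) 2
  have hsq : weight k s n m ^ 2 = (n : ℝ) ^ 2 * A ^ (2 * s) * B⁻¹ * (P * Q) ^ (-(2 * k)) := by
    rw [weight, mul_pow, mul_pow, mul_pow, sq_abs, ← Real.rpow_natCast (_ ^ s),
      ← Real.rpow_natCast (_ ^ (-(1 / 2) : ℝ)), ← Real.rpow_natCast (_ ^ (-k)),
      ← Real.rpow_mul qA.le,
      ← Real.rpow_mul qB.le, ← Real.rpow_mul (by positivity), ← Real.rpow_neg_one B,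
      show s * ((2 : ℕ) : ℝ) = 2 * s by push_cast; ring,
      show -(1 / 2) * ((2 : ℕ) : ℝ) = -1 by push_cast; ring,
      show -k * ((2 : ℕ) : ℝ) = -(2 * k) by push_cast; ring]
  rw [hsq]
  have hC1 : (1 : ℝ) ≤ 256 ^ (2 * k) := Real.one_le_rpow (by norm_num) (by linarith)
  by_cases hj : |(m : ℝ) + ((n : ℝ) ^ 2 - n) / 2| ≤ (n : ℝ) ^ 2 / 8
  · -- near the resonance: `⟨m⟩ ⟨m - n⟩ ≳ ⟨n⟩⁴`
    obtain ⟨g1, g2⟩ := bracket_sq_le_of_near hj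
    have g3 : A ^ (4 : ℝ) / 256 ≤ P * Q := by
      calc A ^ (4 : ℝ) / 256 = (A ^ 2 / 16) * (A ^ 2 / 16) := by
            rw [show (4 : ℝ) = ((4 : ℕ) : ℝ) by norm_num, Real.rpow_natCast]; ring
        _ ≤ P * Q := mul_le_mul g1 g2 (by positivity) qP.le
    have g4 : (P * Q) ^ (-(2 * k)) ≤ 256 ^ (2 * k) * A ^ (-(8 * k)) := by
      refine (Real.rpow_le_rpow_of_nonpos (by positivity) g3 (by linarith)).trans (le_of_eq ?_)
      rw [Real.div_rpow (by positivity) (by norm_num), Real.rpow_neg (by norm_num : (0:ℝ) ≤ 256),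
        ← Real.rpow_mul qA.le, div_inv_eq_mul, mul_comm]
      congr 2; ring
    have g5 : B⁻¹ ≤ J ^ (-κ) := by
      refine (inv_anti₀ qJ (bracket_le_bracket_resonance hn m)).trans ?_
      rw [← Real.rpow_neg_one]
      exact hmon J pJ 1 hκ1
    have g6 : A ^ 2 * A ^ (2 * s) * A ^ (-(8 * k)) ≤ 1 := by
      rw [← Real.rpow_two, ← Real.rpow_add qA, ← Real.rpow_add qA]
      exact Real.rpow_le_one_of_one_le_of_nonpos pA (by linarith)
    calc _ ≤ A ^ 2 * A ^ (2 * s) * J ^ (-κ) * (256 ^ (2 * k) * A ^ (-(8 * k))) := by gcongr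
      _ = 256 ^ (2 * k) * J ^ (-κ) * (A ^ 2 * A ^ (2 * s) * A ^ (-(8 * k))) := by ring
      _ ≤ 256 ^ (2 * k) * J ^ (-κ) * 1 := by gcongr
      _ ≤ _ := by
        have e1 : 0 < P ^ (-κ) := by positivity
        have e2 : 0 < Q ^ (-κ) := by positivity
        have e3 : 0 < J ^ (-κ) := by positivity
        have : 256 ^ (2 * k) * J ^ (-κ) ≤ 16 * 256 ^ (2 * k) * J ^ (-κ) := by
          have : (0:ℝ) < 256 ^ (2 * k) * J ^ (-κ) := by positivity
          linarith
        rw [mul_one]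
        refine this.trans ?_
        gcongr
        linarith
  · -- away from the resonance: `⟨resonance⟩ ≳ ⟨n⟩³`, and the larger input frequency is `≳ ⟨n⟩`
    push Not at hj
    have g1 : A ^ (3 : ℝ) / 16 ≤ B := by
      rw [show (3 : ℝ) = ((3 : ℕ) : ℝ) by norm_num, Real.rpow_natCast, hA, hB, resonance_eq,
        bracket, bracket, abs_mul, abs_mul, abs_two]
      have e1 : (0 : ℝ) ≤ |(n : ℝ)| := abs_nonneg _
      have e2 := mul_le_mul_of_nonneg_left hj.le e1
      have e3 : |(n : ℝ)| * (n : ℝ) ^ 2 = |(n : ℝ)| ^ 3 := by rw [← sq_abs (n : ℝ)]; ring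
      nlinarith [mul_nonneg e1 (sq_nonneg (|(n : ℝ)| - 1)), sq_nonneg (|(n : ℝ)| - 1)]
    have g2 : (n : ℝ) ^ 2 * A ^ (2 * s) * B⁻¹ ≤ 16 * A ^ (2 * k) := by
      have : B⁻¹ ≤ 16 * A ^ (-3 : ℝ) := by
        refine (inv_anti₀ (by positivity) g1).trans (le_of_eq ?_)
        rw [Real.rpow_neg qA.le, inv_div, div_eq_mul_inv]
      calc _ ≤ A ^ 2 * A ^ (2 * s) * (16 * A ^ (-3 : ℝ)) := by gcongr
        _ = 16 * A ^ (2 + 2 * s + -3) := by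
          rw [Real.rpow_add qA, Real.rpow_add qA, Real.rpow_two]; ring
        _ ≤ _ := by
          gcongr 2
          linarith
    have hAPQ : A ≤ P + Q := by
      have := bracket_add_le (m : ℝ) (-((m : ℝ) - n))
      rw [bracket_neg] at this
      simpa using this
    have g3 : ∀ x y : ℝ, 1 ≤ x → x ≤ y → A ≤ x + y →
        (x * y) ^ (-(2 * k)) ≤ 256 ^ (2 * k) * A ^ (-(2 * k)) * x ^ (-κ) := by
      intro x y hx hxy hAx
      have hx0 : 0 < x := by linarith
      have h1 : A * x / 2 ≤ x * y := by nlinarith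
      calc (x * y) ^ (-(2 * k)) ≤ (A * x / 2) ^ (-(2 * k)) :=
            Real.rpow_le_rpow_of_nonpos (by positivity) h1 (by linarith)
        _ = 2 ^ (2 * k) * A ^ (-(2 * k)) * x ^ (-(2 * k)) := by
            rw [Real.div_rpow (by positivity) (by norm_num), Real.mul_rpow qA.le hx0.le,
              Real.rpow_neg (by norm_num : (0:ℝ) ≤ 2), div_inv_eq_mul]
            ring
        _ ≤ _ := by
            gcongr
            · norm_num
    have g4 : (P * Q) ^ (-(2 * k)) ≤ 256 ^ (2 * k) * A ^ (-(2 * k)) * (P ^ (-κ) + Q ^ (-κ)) := by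
      have e1 : 0 < P ^ (-κ) := by positivity
      have e2 : 0 < Q ^ (-κ) := by positivity
      rcases le_total P Q with h | h
      · refine (g3 P Q pP h hAPQ).trans ?_
        gcongr
        linarith
      · rw [mul_comm P Q]
        refine (g3 Q P pQ h (by linarith)).trans ?_
        gcongr
        linarith
    have e3 : 0 < J ^ (-κ) := by positivity
    calc _ ≤ 16 * A ^ (2 * k) * (256 ^ (2 * k) * A ^ (-(2 * k)) * (P ^ (-κ) + Q ^ (-κ))) := by
          gcongr
      _ = 16 * 256 ^ (2 * k) * (P ^ (-κ) + Q ^ (-κ)) := by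
        rw [Real.rpow_neg qA.le]; field_simp
      _ ≤ _ := by gcongr 1; linarith

theorem weight_sq_le_const {k s : ℝ} (hk : 0 < k) (h₁ : 1 + s ≤ 4 * k) (h₂ : -(1 / 2) ≤ k - s)
    (n m : ℤ) : weight k s n m ^ 2 ≤ 48 * 256 ^ (2 * k) := by
  have hκ : 0 ≤ min 1 (2 * k) := by positivity
  refine (weight_sq_le hk h₁ h₂ n m).trans ?_
  have e1 := bracket_rpow_neg_le_one (m + ((n : ℝ) ^ 2 - n) / 2) hκ
  have e2 := bracket_rpow_neg_le_one (m : ℝ) hκ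
  have e3 := bracket_rpow_neg_le_one (m + -(n : ℝ)) hκ
  have : (0 : ℝ) < 256 ^ (2 * k) := by positivity
  nlinarith

theorem abs_mul_bracket_rpow_eq (k s : ℝ) (n m : ℤ) :
    |(n : ℝ)| * bracket n ^ s = weight k s n m * bracket (resonance n m) ^ (1 / 2 : ℝ) *
      (bracket m ^ k * bracket ((m : ℝ) - n) ^ k) := by
  have h2 := bracket_pos m; have h3 := bracket_pos ((m : ℝ) - n)
  have h4 := bracket_pos (resonance n m)
  rw [weight, Real.mul_rpow h2.le h3.le, Real.rpow_neg h4.le, Real.rpow_neg h2.le,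
    Real.rpow_neg h3.le]
  field_simp

/-- The three-term distribution of half a power of the resonance over the modulations, for the
`L²` part of the norm. The term `S₁ ^ δ`, which could be `1`, leaves the powers `1/2` and `1/2 - δ`
of the two input modulations after division by `S₁ ^ (1/2 - δ) * S₂ ^ (1/2 - δ)`. -/
theorem rpow_modulation_le {B S S₁ S₂ δ : ℝ} (hδ : 0 ≤ δ) (hB : 1 ≤ B) (hS : 1 ≤ S)
    (hS₁ : 1 ≤ S₁) (hS₂ : 1 ≤ S₂) (h : B ≤ S + S₁ + S₂) :
    S ^ (-(1 / 2) : ℝ) * B ^ (1 / 2 : ℝ) ≤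
      S₁ ^ δ + S₁ ^ (1 / 2 : ℝ) * S ^ (-(1 / 2 - δ)) + S₂ ^ (1 / 2 : ℝ) * S ^ (-(1 / 2 - δ)) := by
  have qS : 0 < S := by linarith
  have e1 : B ^ (1 / 2 : ℝ) ≤ S ^ (1 / 2 : ℝ) + S₁ ^ (1 / 2 : ℝ) + S₂ ^ (1 / 2 : ℝ) := by
    refine (Real.rpow_le_rpow (by linarith) h (by norm_num)).trans ?_
    refine (Real.rpow_add_le_add_rpow (by linarith) (by linarith) (by norm_num)
      (by norm_num)).trans ?_
    gcongr
    exact Real.rpow_add_le_add_rpow (by linarith) (by linarith) (by norm_num) (by norm_num)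
  have e2 : S ^ (-(1 / 2) : ℝ) ≤ S ^ (-(1 / 2 - δ)) :=
    Real.rpow_le_rpow_of_exponent_le hS (by linarith)
  have e3 : S ^ (-(1 / 2) : ℝ) * S ^ (1 / 2 : ℝ) = 1 := by
    rw [← Real.rpow_add qS]; norm_num
  have e4 : 1 ≤ S₁ ^ δ := Real.one_le_rpow hS₁ hδ
  calc _ ≤ S ^ (-(1 / 2) : ℝ) * (S ^ (1 / 2 : ℝ) + S₁ ^ (1 / 2 : ℝ) + S₂ ^ (1 / 2 : ℝ)) := by gcongr
    _ = 1 + S₁ ^ (1 / 2 : ℝ) * S ^ (-(1 / 2) : ℝ) + S₂ ^ (1 / 2 : ℝ) * S ^ (-(1 / 2) : ℝ) := by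
      rw [mul_add, mul_add, e3]; ring
    _ ≤ _ := by gcongr

/-- The analogous distribution for the `L¹` part of the norm. Where `S` is the largest modulation,
small powers of it are given to `S₁` and `S₂`, to make them integrable. -/
theorem inv_modulation_le {B S S₁ S₂ δ : ℝ} (hδ : 0 ≤ δ) (hδ' : δ ≤ 1 / 4) (hB : 1 ≤ B) (hS : 1 ≤ S)
    (hS₁ : 1 ≤ S₁) (hS₂ : 1 ≤ S₂) (h : B ≤ S + S₁ + S₂) :
    S⁻¹ * B ^ (1 / 2 : ℝ) ≤ 3 * (B ^ (-(1 / 2 - 4 * δ)) * S₁ ^ (-(2 * δ)) * S₂ ^ (-(2 * δ)) +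
      S₁ ^ (1 / 2 : ℝ) * S⁻¹ + S₂ ^ (1 / 2 : ℝ) * S⁻¹) := by
  have qS : 0 < S := by linarith
  have qB : 0 < B := by linarith
  have t1 : 0 ≤ B ^ (-(1 / 2 - 4 * δ)) * S₁ ^ (-(2 * δ)) * S₂ ^ (-(2 * δ)) := by positivity
  have t2 : 0 ≤ S₁ ^ (1 / 2 : ℝ) * S⁻¹ := by positivity
  have t3 : 0 ≤ S₂ ^ (1 / 2 : ℝ) * S⁻¹ := by positivity
  have hlarge : ∀ T : ℝ, 1 ≤ T → B ≤ 3 * T → B ^ (1 / 2 : ℝ) ≤ 3 * T ^ (1 / 2 : ℝ) := by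
    intro T hT hBT
    refine (Real.rpow_le_rpow qB.le hBT (by norm_num)).trans ?_
    rw [Real.mul_rpow (by norm_num) (by linarith)]
    gcongr
    exact (Real.rpow_le_rpow_of_exponent_le (by norm_num) (by norm_num : (1/2:ℝ) ≤ 1)).trans
      (by simp)
  by_cases h1 : S ≤ S₁ ∧ S₂ ≤ S₁
  · have := hlarge S₁ hS₁ (by linarith [h1.1, h1.2])
    calc _ ≤ S⁻¹ * (3 * S₁ ^ (1 / 2 : ℝ)) := by gcongr
      _ ≤ _ := by linarith
  by_cases h2 : S ≤ S₂ ∧ S₁ ≤ S₂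
  · have := hlarge S₂ hS₂ (by linarith [h2.1, h2.2])
    calc _ ≤ S⁻¹ * (3 * S₂ ^ (1 / 2 : ℝ)) := by gcongr
      _ ≤ _ := by linarith
  have h3 : S₁ ≤ S ∧ S₂ ≤ S := by grind
  have e1 : S⁻¹ = S ^ (-(1 - 4 * δ)) * S ^ (-(2 * δ)) * S ^ (-(2 * δ)) := by
    rw [← Real.rpow_add qS, ← Real.rpow_add qS, ← Real.rpow_neg_one]; congr 1; ring
  have e2 : S ^ (-(1 - 4 * δ)) ≤ 3 * B ^ (-(1 - 4 * δ)) := by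
    have : B / 3 ≤ S := by linarith [h3.1, h3.2]
    refine (Real.rpow_le_rpow_of_nonpos (by positivity) this (by linarith)).trans ?_
    rw [Real.div_rpow qB.le (by norm_num), Real.rpow_neg (by norm_num : (0:ℝ) ≤ 3), div_inv_eq_mul,
      mul_comm]
    gcongr
    exact (Real.rpow_le_rpow_of_exponent_le (by norm_num) (by linarith : 1 - 4 * δ ≤ 1)).trans
      (by simp)
  have e3 : S ^ (-(2 * δ)) ≤ S₁ ^ (-(2 * δ)) :=
    Real.rpow_le_rpow_of_nonpos (by linarith) h3.1 (by linarith)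
  have e4 : S ^ (-(2 * δ)) ≤ S₂ ^ (-(2 * δ)) :=
    Real.rpow_le_rpow_of_nonpos (by linarith) h3.2 (by linarith)
  have e5 : B ^ (-(1 - 4 * δ)) * B ^ (1 / 2 : ℝ) = B ^ (-(1 / 2 - 4 * δ)) := by
    rw [← Real.rpow_add qB]; congr 1; ring
  calc _ ≤ 3 * B ^ (-(1 - 4 * δ)) * S₁ ^ (-(2 * δ)) * S₂ ^ (-(2 * δ)) * B ^ (1 / 2 : ℝ) := by
        rw [e1]; gcongr
    _ = 3 * ((B ^ (-(1 - 4 * δ)) * B ^ (1 / 2 : ℝ)) * S₁ ^ (-(2 * δ)) * S₂ ^ (-(2 * δ))) := by ring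
    _ ≤ _ := by rw [e5]; gcongr; linarith

/-! ### Cauchy–Schwarz estimates of weighted correlations -/

section Schur

theorem sq_lintegral_mul_le {α : Type*} [MeasurableSpace α] (μ : Measure α) {f g : α → ℝ≥0∞}
    (hf : AEMeasurable f μ) (hg : AEMeasurable g μ) :
    (∫⁻ x, f x * g x ∂μ) ^ 2 ≤ (∫⁻ x, f x ^ 2 ∂μ) * ∫⁻ x, g x ^ 2 ∂μ := by
  have h := pow_le_pow_left₀ zero_le
    (ENNReal.lintegral_mul_le_Lp_mul_Lq μ Real.HolderConjugate.two_two hf hg) 2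
  have e : ∀ a : ℝ≥0∞, (a ^ (1 / 2 : ℝ)) ^ 2 = a := fun a => by
    rw [← ENNReal.rpow_natCast, ← ENNReal.rpow_mul]; norm_num
  rw [mul_pow, e, e] at h
  simpa using h

variable {G : Type*} [AddCommGroup G] [MeasurableSpace G] [MeasurableAdd₂ G] [MeasurableNeg G]
  {μ : Measure G} [SFinite μ] [μ.IsAddLeftInvariant]

theorem measurable_comp_sub {g : G → ℝ≥0∞} (hg : Measurable g) :
    Measurable fun p : G × G => g (p.2 - p.1) := by
  have : Measurable fun p : G × G => p.2 - p.1 := by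
    simp only [sub_eq_add_neg]
    exact measurable_snd.add measurable_fst.neg
  exact hg.comp this

/-- The `L²` norm of the tensor product `f ⊗ g` in the coordinates `(x - y, x)`. -/
theorem lintegral_lintegral_sq_mul_sq [μ.IsNegInvariant] {f g : G → ℝ≥0∞}
    (hf : Measurable f) (hg : Measurable g) :
    ∫⁻ y, ∫⁻ x, (f x * g (x - y)) ^ 2 ∂μ ∂μ = (∫⁻ x, f x ^ 2 ∂μ) * ∫⁻ x, g x ^ 2 ∂μ := by
  have hgm := measurable_comp_sub hg
  rw [lintegral_lintegral_swap (Measurable.aemeasurable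
    (((hf.comp measurable_snd).mul hgm).pow_const 2)),
    ← lintegral_mul_const _ (hf.pow_const 2)]
  refine lintegral_congr fun x => ?_
  simp only [mul_pow]
  have hgx : Measurable fun y => g (x - y) ^ 2 := (hgm.comp measurable_prodMk_right).pow_const 2
  rw [lintegral_const_mul _ hgx]
  congr 1
  exact lintegral_sub_left_eq_self (fun z => g z ^ 2) x

/-- Cauchy–Schwarz estimate of a weighted correlation, the kernel being square-integrable in the
integration variable. -/
theorem lintegral_sq_correlation_le [μ.IsNegInvariant] {f g : G → ℝ≥0∞} (hf : Measurable f)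
    (hg : Measurable g)
    {K : G → G → ℝ≥0∞} (hK : Measurable (Function.uncurry K)) {A : ℝ≥0∞}
    (hA : ∀ y, ∫⁻ x, K y x ^ 2 ∂μ ≤ A) :
    ∫⁻ y, (∫⁻ x, K y x * (f x * g (x - y)) ∂μ) ^ 2 ∂μ ≤
      A * ((∫⁻ x, f x ^ 2 ∂μ) * ∫⁻ x, g x ^ 2 ∂μ) := by
  have hgm := measurable_comp_sub hg
  have hm : Measurable fun p : G × G => f p.2 * g (p.2 - p.1) := (hf.comp measurable_snd).mul hgm
  calc _ ≤ ∫⁻ y, A * ∫⁻ x, (f x * g (x - y)) ^ 2 ∂μ ∂μ := by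
        refine lintegral_mono fun y => ?_
        refine (sq_lintegral_mul_le μ (hK.comp measurable_prodMk_left).aemeasurable
          (hm.comp measurable_prodMk_left).aemeasurable).trans ?_
        exact mul_le_mul' (hA y) le_rfl
    _ = _ := by
        rw [lintegral_const_mul _ (hm.pow_const 2).lintegral_prod_right',
          lintegral_lintegral_sq_mul_sq hf hg]

/-- The same estimate, the kernel being square-integrable in the output variable for a fixed
first factor. -/
theorem lintegral_sq_correlation_le_of_fst {f g : G → ℝ≥0∞} (hf : Measurable f) (hg : Measurable g)
    {K : G → G → ℝ≥0∞} (hK : Measurable (Function.uncurry K)) {A : ℝ≥0∞}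
    (hA : ∀ x, ∫⁻ y, K y x ^ 2 ∂μ ≤ A) :
    ∫⁻ y, (∫⁻ x, K y x * (f x * g (x - y)) ∂μ) ^ 2 ∂μ ≤
      A * ((∫⁻ x, f x ^ 2 ∂μ) * ∫⁻ x, g x ^ 2 ∂μ) := by
  have hgm := measurable_comp_sub hg
  have hm : Measurable fun p : G × G => K p.1 p.2 * f p.2 := hK.mul (hf.comp measurable_snd)
  calc _ ≤ ∫⁻ y, (∫⁻ x, (K y x * f x) ^ 2 ∂μ) * ∫⁻ x, g x ^ 2 ∂μ ∂μ := by
        refine lintegral_mono fun y => ?_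
        simp only [← mul_assoc]
        refine (sq_lintegral_mul_le μ (hm.comp measurable_prodMk_left).aemeasurable
          (hgm.comp measurable_prodMk_left).aemeasurable).trans (le_of_eq ?_)
        congr 1
        exact lintegral_sub_right_eq_self (fun z => g z ^ 2) y
    _ = (∫⁻ x, (∫⁻ y, K y x ^ 2 ∂μ) * f x ^ 2 ∂μ) * ∫⁻ x, g x ^ 2 ∂μ := by
        rw [lintegral_mul_const _ (hm.pow_const 2).lintegral_prod_right',
          lintegral_lintegral_swap (hm.pow_const 2).aemeasurable]
        congr 1
        refine lintegral_congr fun x => ?_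
        simp only [mul_pow]
        exact lintegral_mul_const _ ((hK.comp measurable_prodMk_right).pow_const 2)
    _ ≤ (∫⁻ x, A * f x ^ 2 ∂μ) * ∫⁻ x, g x ^ 2 ∂μ := by
        gcongr with x
        exact hA x
    _ = _ := by rw [lintegral_const_mul _ (hf.pow_const 2), mul_assoc]

/-- The same estimate, the kernel being square-integrable in the output variable for a fixed
second factor. -/
theorem lintegral_sq_correlation_le_of_snd {f g : G → ℝ≥0∞} (hf : Measurable f) (hg : Measurable g)
    {K : G → G → ℝ≥0∞} (hK : Measurable (Function.uncurry K)) {A : ℝ≥0∞}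
    (hA : ∀ z, ∫⁻ y, K y (z + y) ^ 2 ∂μ ≤ A) :
    ∫⁻ y, (∫⁻ x, K y x * (f x * g (x - y)) ∂μ) ^ 2 ∂μ ≤
      A * ((∫⁻ x, f x ^ 2 ∂μ) * ∫⁻ x, g x ^ 2 ∂μ) := by
  have hgm := measurable_comp_sub hg
  have hm : Measurable fun p : G × G => K p.1 p.2 * g (p.2 - p.1) := hK.mul hgm
  have hK' : Measurable fun p : G × G => K p.1 (p.2 + p.1) :=
    hK.comp (measurable_fst.prodMk (measurable_snd.add measurable_fst))
  have hm' : Measurable fun p : G × G => K p.1 (p.2 + p.1) * g p.2 :=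
    hK'.mul (hg.comp measurable_snd)
  calc _ ≤ ∫⁻ y, (∫⁻ x, f x ^ 2 ∂μ) * ∫⁻ z, (K y (z + y) * g z) ^ 2 ∂μ ∂μ := by
        refine lintegral_mono fun y => ?_
        simp only [mul_left_comm (K y _)]
        refine (sq_lintegral_mul_le μ hf.aemeasurable
          (hm.comp measurable_prodMk_left).aemeasurable).trans (le_of_eq ?_)
        congr 1
        rw [← lintegral_add_right_eq_self _ y]
        simp
    _ = (∫⁻ x, f x ^ 2 ∂μ) * ∫⁻ z, (∫⁻ y, K y (z + y) ^ 2 ∂μ) * g z ^ 2 ∂μ := by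
        rw [lintegral_const_mul _ (hm'.pow_const 2).lintegral_prod_right',
          lintegral_lintegral_swap (hm'.pow_const 2).aemeasurable]
        congr 1
        refine lintegral_congr fun x => ?_
        simp only [mul_pow]
        exact lintegral_mul_const _ ((hK'.comp measurable_prodMk_right).pow_const 2)
    _ ≤ (∫⁻ x, f x ^ 2 ∂μ) * ∫⁻ z, A * g z ^ 2 ∂μ := by
        gcongr with x
        exact hA x
    _ = _ := by rw [lintegral_const_mul _ (hg.pow_const 2)]; ring

end Schur

/-- The product of counting measure and Lebesgue measure on the frequency space `ℤ × ℝ`. -/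
def freqMeasure : Measure (ℤ × ℝ) := Measure.count.prod volume

instance : SigmaFinite freqMeasure := by unfold freqMeasure; infer_instance

instance : freqMeasure.IsAddLeftInvariant := by unfold freqMeasure; infer_instance

instance : freqMeasure.IsNegInvariant := by
  constructor
  rw [Measure.neg]
  exact ((Measure.measurePreserving_neg (Measure.count : Measure ℤ)).prod
    (Measure.measurePreserving_neg (volume : Measure ℝ))).map_eq

theorem lintegral_freqMeasure {f : ℤ × ℝ → ℝ≥0∞} (hf : Measurable f) :
    ∫⁻ x, f x ∂freqMeasure = ∑' n : ℤ, ∫⁻ τ : ℝ, f (n, τ) := by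
  rw [freqMeasure, lintegral_prod _ hf.aemeasurable, lintegral_count]

/-- The Cauchy–Schwarz estimate of a weighted correlation in the norm `L²ₙ L¹_τ`, the kernel being
square-integrable in the time frequency of the output and in the integration variable. -/
theorem tsum_sq_lintegral_correlation_le {f g : ℤ × ℝ → ℝ≥0∞} (hf : Measurable f)
    (hg : Measurable g) {K : ℤ × ℝ → ℤ × ℝ → ℝ≥0∞} (hK : Measurable (Function.uncurry K))
    {A : ℝ≥0∞} (hA : ∀ n, ∫⁻ τ : ℝ, ∫⁻ x, K (n, τ) x ^ 2 ∂freqMeasure ≤ A) :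
    ∑' n : ℤ, (∫⁻ τ : ℝ, ∫⁻ x, K (n, τ) x * (f x * g (x - (n, τ))) ∂freqMeasure) ^ 2 ≤
      A * ((∫⁻ x, f x ^ 2 ∂freqMeasure) * ∫⁻ x, g x ^ 2 ∂freqMeasure) := by
  have hgm := measurable_comp_sub hg
  have hm : Measurable fun p : (ℤ × ℝ) × (ℤ × ℝ) => f p.2 * g (p.2 - p.1) :=
    (hf.comp measurable_snd).mul hgm
  have hι : ∀ n : ℤ, Measurable fun p : ℝ × (ℤ × ℝ) => (((n, p.1), p.2) : (ℤ × ℝ) × (ℤ × ℝ)) :=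
    fun n => (measurable_const.prodMk measurable_fst).prodMk measurable_snd
  rw [← lintegral_lintegral_sq_mul_sq hf hg,
    lintegral_freqMeasure (hm.pow_const 2).lintegral_prod_right', ← ENNReal.tsum_mul_left]
  refine ENNReal.tsum_le_tsum fun n => ?_
  have hK' : Measurable fun p : ℝ × (ℤ × ℝ) => K (n, p.1) p.2 := hK.comp (hι n)
  have hm' : Measurable fun p : ℝ × (ℤ × ℝ) => f p.2 * g (p.2 - (n, p.1)) := hm.comp (hι n)
  have h := sq_lintegral_mul_le ((volume : Measure ℝ).prod freqMeasure) hK'.aemeasurable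
    hm'.aemeasurable
  have hKm : Measurable fun p : ℝ × (ℤ × ℝ) => K (n, p.1) p.2 * (f p.2 * g (p.2 - (n, p.1))) :=
    hK'.mul hm'
  rw [lintegral_prod _ hKm.aemeasurable, lintegral_prod _ (hK'.pow_const 2).aemeasurable,
    lintegral_prod _ (hm'.pow_const 2).aemeasurable] at h
  exact h.trans (mul_le_mul' (hA n) le_rfl)

/-! ### Bounds for the kernels -/

/-- The modulation bracket `⟨τ + n²⟩` of the Schrödinger flow. -/
def modS (x : ℤ × ℝ) : ℝ := bracket (x.2 + (x.1 : ℝ) ^ 2)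

/-- The modulation bracket `⟨τ - n³⟩` of the Airy flow. -/
def modK (y : ℤ × ℝ) : ℝ := bracket (y.2 - (y.1 : ℝ) ^ 3)

theorem one_le_modS (x : ℤ × ℝ) : 1 ≤ modS x := one_le_bracket _

theorem one_le_modK (x : ℤ × ℝ) : 1 ≤ modK x := one_le_bracket _

theorem modS_pos (x : ℤ × ℝ) : 0 < modS x := bracket_pos _

theorem modK_pos (x : ℤ × ℝ) : 0 < modK x := bracket_pos _

theorem measurable_modS : Measurable modS :=
  measurable_bracket.comp (measurable_snd.add
    ((measurable_of_countable fun n : ℤ => (n : ℝ) ^ 2).comp measurable_fst))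

theorem measurable_modK : Measurable modK :=
  measurable_bracket.comp (measurable_snd.sub
    ((measurable_of_countable fun n : ℤ => (n : ℝ) ^ 3).comp measurable_fst))

/-- The resonance identity: the largest of the three modulations is at least a third of the
resonance function. -/
theorem bracket_resonance_le (y x : ℤ × ℝ) :
    bracket (resonance y.1 x.1) ≤ modK y + modS x + modS (x - y) := by
  have h : resonance y.1 x.1 = -(y.2 - (y.1 : ℝ) ^ 3) + (x.2 + (x.1 : ℝ) ^ 2) +
      -((x - y).2 + (((x - y).1 : ℤ) : ℝ) ^ 2) := by
    simp only [resonance, Prod.fst_sub, Prod.snd_sub]; push_cast; ring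
  rw [h]
  refine (bracket_add_le _ _).trans ?_
  rw [bracket_neg]
  refine add_le_add_left ((bracket_add_le _ _).trans ?_) _
  rw [bracket_neg]
  rfl

/-- The kernel for the region where the output modulation dominates. -/
def kernelOut (k s δ : ℝ) (y x : ℤ × ℝ) : ℝ :=
  weight k s y.1 x.1 * (modS x ^ (-(1 / 2 - δ)) * modS (x - y) ^ (-(1 / 2 - δ)))

/-- The kernel for the region where the modulation of the first factor dominates. -/
def kernelFst (k s δ : ℝ) (y x : ℤ × ℝ) : ℝ :=
  weight k s y.1 x.1 * (modK y ^ (-(1 / 2 - δ)) * modS (x - y) ^ (-(1 / 2 - δ)))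

/-- The kernel for the region where the modulation of the second factor dominates. -/
def kernelSnd (k s δ : ℝ) (y x : ℤ × ℝ) : ℝ :=
  weight k s y.1 x.1 * (modK y ^ (-(1 / 2 - δ)) * modS x ^ (-(1 / 2 - δ)))

/-- The kernel for the region where the output modulation dominates, in the `L¹` part of the
norm. -/
def kernelOutL1 (k s δ : ℝ) (y x : ℤ × ℝ) : ℝ :=
  weight k s y.1 x.1 * bracket (resonance y.1 x.1) ^ (-(1 / 2 - 4 * δ)) *
    (modS x ^ (-(1 / 2 + δ)) * modS (x - y) ^ (-(1 / 2 + δ)))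

theorem measurable_comp_fst_fst (φ : ℤ → ℤ → ℝ) :
    Measurable fun p : (ℤ × ℝ) × (ℤ × ℝ) => φ p.1.1 p.2.1 :=
  (measurable_of_countable fun q : ℤ × ℤ => φ q.1 q.2).comp
    ((measurable_fst.comp measurable_fst).prodMk (measurable_fst.comp measurable_snd))

theorem measurable_modS_sub : Measurable fun p : (ℤ × ℝ) × (ℤ × ℝ) => modS (p.2 - p.1) :=
  measurable_modS.comp (measurable_snd.sub measurable_fst)

theorem measurable_kernelOut (k s δ : ℝ) : Measurable (Function.uncurry (kernelOut k s δ)) :=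
  (measurable_comp_fst_fst _).mul (((measurable_modS.comp measurable_snd).pow_const _).mul
    (measurable_modS_sub.pow_const _))

theorem measurable_kernelFst (k s δ : ℝ) : Measurable (Function.uncurry (kernelFst k s δ)) :=
  (measurable_comp_fst_fst _).mul (((measurable_modK.comp measurable_fst).pow_const _).mul
    (measurable_modS_sub.pow_const _))

theorem measurable_kernelSnd (k s δ : ℝ) : Measurable (Function.uncurry (kernelSnd k s δ)) :=
  (measurable_comp_fst_fst _).mul (((measurable_modK.comp measurable_fst).pow_const _).mul
    ((measurable_modS.comp measurable_snd).pow_const _))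

theorem measurable_kernelOutL1 (k s δ : ℝ) : Measurable (Function.uncurry (kernelOutL1 k s δ)) :=
  (measurable_comp_fst_fst fun n m => weight k s n m *
    bracket (resonance n m) ^ (-(1 / 2 - 4 * δ))).mul
    (((measurable_modS.comp measurable_snd).pow_const _).mul (measurable_modS_sub.pow_const _))

theorem sq_mul_rpow_neg_mul_rpow_neg (w : ℝ) {x y : ℝ} (hx : 0 ≤ x) (hy : 0 ≤ y) (a : ℝ) :
    (w * (x ^ (-a) * y ^ (-a))) ^ 2 = w ^ 2 * (x ^ (-(2 * a)) * y ^ (-(2 * a))) := by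
  rw [mul_pow, mul_pow, ← Real.rpow_natCast (x ^ _), ← Real.rpow_natCast (y ^ _),
    ← Real.rpow_mul hx, ← Real.rpow_mul hy]
  congr 3 <;> push_cast <;> ring_nf

/-- Uniform bound for the weight against brackets along an arithmetic progression. -/
theorem exists_tsum_weight_sq_mul_le {k s γ : ℝ} (hk : 0 < k) (h₁ : 1 + s ≤ 4 * k)
    (h₂ : -(1 / 2) ≤ k - s) (hγ : 0 ≤ γ) (h : 1 < min 1 (2 * k) + γ) :
    ∃ C : ℝ≥0, ∀ (n : ℤ) (a b : ℝ), 1 ≤ |b| → ∑' m : ℤ,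
      ENNReal.ofReal (weight k s n m ^ 2 * bracket (b * m + a) ^ (-γ)) ≤ C := by
  obtain ⟨C, hC⟩ := exists_tsum_bracket_mul_le (κ := min 1 (2 * k)) (by positivity) hγ h
  refine ⟨(16 * 256 ^ (2 * k) : ℝ).toNNReal * (C + C + C), fun n a b hb => ?_⟩
  have hP : (0 : ℝ) ≤ 16 * 256 ^ (2 * k) := by positivity
  have hb' := fun m : ℤ => bracket_rpow_pos (b * m + a) (-γ)
  set κ := min 1 (2 * k)
  calc _ ≤ ∑' m : ℤ, ENNReal.ofReal (16 * 256 ^ (2 * k)) *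
        (ENNReal.ofReal (bracket (m + ((n : ℝ) ^ 2 - n) / 2) ^ (-κ) * bracket (b * m + a) ^ (-γ)) +
        ENNReal.ofReal (bracket (m + 0) ^ (-κ) * bracket (b * m + a) ^ (-γ)) +
        ENNReal.ofReal (bracket (m + -(n : ℝ)) ^ (-κ) * bracket (b * m + a) ^ (-γ))) := by
        refine ENNReal.tsum_le_tsum fun m => ?_
        have p := fun c : ℝ => (mul_pos (bracket_rpow_pos (m + c) (-κ)) (hb' m)).le
        rw [← ENNReal.ofReal_add (p _) (p _), ← ENNReal.ofReal_add (add_nonneg (p _) (p _)) (p _),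
          ← ENNReal.ofReal_mul hP]
        refine ENNReal.ofReal_le_ofReal ?_
        refine (mul_le_mul_of_nonneg_right (weight_sq_le hk h₁ h₂ n m) (hb' m).le).trans
          (le_of_eq ?_)
        rw [add_zero]
        ring
    _ ≤ _ := by
        rw [ENNReal.tsum_mul_left, ENNReal.tsum_add, ENNReal.tsum_add]
        push_cast
        gcongr
        · exact le_rfl
        · exact hC _ _ _ hb
        · exact hC _ _ _ hb
        · exact hC _ _ _ hb

section KernelBounds

variable {k s δ : ℝ}

/-- After integration in the time frequency, what remains is a sum along the arithmetic progression
`τ - n² + 2nm`; the output frequency `n = 0` does not contribute. -/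
theorem exists_lintegral_kernelOut_le (hk : 0 < k) (h₁ : 1 + s ≤ 4 * k)
    (h₂ : -(1 / 2) ≤ k - s) (hδ : 0 < δ) (hδκ : 16 * δ ≤ min 1 (2 * k)) :
    ∃ A : ℝ≥0, ∀ y, ∫⁻ x, ENNReal.ofReal (kernelOut k s δ y x) ^ 2 ∂freqMeasure ≤ A := by
  have hδ1 : 16 * δ ≤ 1 := hδκ.trans (min_le_left _ _)
  obtain ⟨C, hC⟩ := exists_lintegral_bracket_mul_le (β := 2 * (1 / 2 - δ)) (γ := 1 - 5 * δ)
    (by linarith) (by linarith) (by linarith)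
  obtain ⟨D, hD⟩ := exists_tsum_weight_sq_mul_le (γ := 1 - 5 * δ) hk h₁ h₂ (by linarith)
    (by linarith)
  refine ⟨C * D, fun ⟨n, τ⟩ => ?_⟩
  have hm : Measurable fun x => ENNReal.ofReal (kernelOut k s δ (n, τ) x) ^ 2 :=
    ((measurable_kernelOut k s δ).comp measurable_prodMk_left).ennreal_ofReal.pow_const 2
  rw [lintegral_freqMeasure hm]
  rcases eq_or_ne n 0 with rfl | hn
  · simp [kernelOut, weight_zero_left]
  calc _ ≤ ∑' m : ℤ, C * ENNReal.ofReal (weight k s n m ^ 2 *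
        bracket (2 * n * m + (τ - (n : ℝ) ^ 2)) ^ (-(1 - 5 * δ))) := by
        refine ENNReal.tsum_le_tsum fun m => ?_
        have e : ∀ σ : ℝ, ENNReal.ofReal (kernelOut k s δ (n, τ) (m, σ)) ^ 2 =
            ENNReal.ofReal (weight k s n m ^ 2) *
            ENNReal.ofReal (bracket (σ + (m : ℝ) ^ 2) ^ (-(2 * (1 / 2 - δ))) *
              bracket (σ + (-τ + ((m : ℝ) - n) ^ 2)) ^ (-(2 * (1 / 2 - δ)))) := fun σ => by
          have hm1 : modS ((m, σ) - (n, τ)) = bracket (σ + (-τ + ((m : ℝ) - n) ^ 2)) := by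
            simp only [modS, Prod.mk_sub_mk]; push_cast; congr 1; ring
          rw [← ENNReal.ofReal_mul (sq_nonneg _), ← ENNReal.ofReal_pow, kernelOut, hm1,
            sq_mul_rpow_neg_mul_rpow_neg _ (modS_pos _).le (bracket_pos _).le]
          · rfl
          · have := weight_nonneg k s n m; have := modS_pos (m, σ)
            have := modS_pos ((m, σ) - (n, τ))
            unfold kernelOut; positivity
        simp only [e]
        rw [lintegral_const_mul' _ _ ENNReal.ofReal_ne_top, ENNReal.ofReal_mul (sq_nonneg _),
          mul_left_comm]
        refine mul_le_mul' le_rfl ((hC _ _).trans (le_of_eq ?_))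
        congr 4; ring
    _ ≤ C * D := by
        rw [ENNReal.tsum_mul_left]
        refine mul_le_mul' le_rfl (hD n _ (2 * n) ?_)
        have : (1 : ℝ) ≤ |(n : ℝ)| := by exact_mod_cast Int.one_le_abs hn
        rw [abs_mul, abs_two]; linarith

/-- After integration in the time frequency, what remains is a sum over the values of a monic cubic
in the output frequency `n`. -/
theorem exists_lintegral_kernelFst_le (hk : 0 < k) (h₁ : 1 + s ≤ 4 * k)
    (h₂ : -(1 / 2) ≤ k - s) (hδ : 0 < δ) (hδ1 : 16 * δ ≤ 1) :
    ∃ A : ℝ≥0, ∀ x, ∫⁻ y, ENNReal.ofReal (kernelFst k s δ y x) ^ 2 ∂freqMeasure ≤ A := by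
  obtain ⟨C, hC⟩ := exists_lintegral_bracket_mul_le (β := 2 * (1 / 2 - δ)) (γ := 1 - 5 * δ)
    (by linarith) (by linarith) (by linarith)
  obtain ⟨D, hD⟩ := exists_tsum_bracket_cubic_le (γ := 1 - 5 * δ) (by linarith)
  refine ⟨(48 * 256 ^ (2 * k) : ℝ).toNNReal * (C * D), fun ⟨m, σ⟩ => ?_⟩
  have hm : Measurable fun y => ENNReal.ofReal (kernelFst k s δ y (m, σ)) ^ 2 :=
    ((measurable_kernelFst k s δ).comp measurable_prodMk_right).ennreal_ofReal.pow_const 2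
  rw [lintegral_freqMeasure hm, ENNReal.coe_mul, ENNReal.coe_mul]
  calc _ ≤ ∑' n : ℤ, ENNReal.ofReal (48 * 256 ^ (2 * k)) * (C * ENNReal.ofReal
        (bracket ((n : ℝ) ^ 3 + (-1) * n ^ 2 + (2 * m) * n + (-(m : ℝ) ^ 2 - σ))
          ^ (-(1 - 5 * δ)))) := by
        refine ENNReal.tsum_le_tsum fun n => ?_
        have e : ∀ τ : ℝ, ENNReal.ofReal (kernelFst k s δ (n, τ) (m, σ)) ^ 2 =
            ENNReal.ofReal (weight k s n m ^ 2) *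
            ENNReal.ofReal (bracket (τ + -(n : ℝ) ^ 3) ^ (-(2 * (1 / 2 - δ))) *
              bracket (τ + (-σ - ((m : ℝ) - n) ^ 2)) ^ (-(2 * (1 / 2 - δ)))) := fun τ => by
          have hm1 : modS ((m, σ) - (n, τ)) = bracket (τ + (-σ - ((m : ℝ) - n) ^ 2)) := by
            rw [← bracket_neg]
            simp only [modS, Prod.mk_sub_mk]; push_cast; congr 1; ring
          rw [← ENNReal.ofReal_mul (sq_nonneg _), ← ENNReal.ofReal_pow, kernelFst, hm1,
            sq_mul_rpow_neg_mul_rpow_neg _ (modK_pos _).le (bracket_pos _).le]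
          · rfl
          · have := weight_nonneg k s n m; have := modK_pos (n, τ)
            have := modS_pos ((m, σ) - (n, τ))
            unfold kernelFst; positivity
        simp only [e]
        rw [lintegral_const_mul' _ _ ENNReal.ofReal_ne_top]
        refine mul_le_mul' (ENNReal.ofReal_le_ofReal (weight_sq_le_const hk h₁ h₂ n m))
          ((hC _ _).trans (le_of_eq ?_))
        rw [← bracket_neg]
        congr 4; ring
    _ ≤ _ := by
        rw [ENNReal.tsum_mul_left, ENNReal.tsum_mul_left]
        exact mul_le_mul' le_rfl (mul_le_mul' le_rfl (hD _ _ _))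

/-- As for `exists_lintegral_kernelFst_le`, with the frequency of the second factor held fixed. -/
theorem exists_lintegral_kernelSnd_le (hk : 0 < k) (h₁ : 1 + s ≤ 4 * k)
    (h₂ : -(1 / 2) ≤ k - s) (hδ : 0 < δ) (hδ1 : 16 * δ ≤ 1) :
    ∃ A : ℝ≥0, ∀ z, ∫⁻ y, ENNReal.ofReal (kernelSnd k s δ y (z + y)) ^ 2 ∂freqMeasure ≤ A := by
  obtain ⟨C, hC⟩ := exists_lintegral_bracket_mul_le (β := 2 * (1 / 2 - δ)) (γ := 1 - 5 * δ)
    (by linarith) (by linarith) (by linarith)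
  obtain ⟨D, hD⟩ := exists_tsum_bracket_cubic_le (γ := 1 - 5 * δ) (by linarith)
  refine ⟨(48 * 256 ^ (2 * k) : ℝ).toNNReal * (C * D), fun ⟨m, σ⟩ => ?_⟩
  have hm : Measurable fun y => ENNReal.ofReal (kernelSnd k s δ y ((m, σ) + y)) ^ 2 :=
    ((measurable_kernelSnd k s δ).comp
      (measurable_id.prodMk (measurable_id.const_add _))).ennreal_ofReal.pow_const 2
  rw [lintegral_freqMeasure hm, ENNReal.coe_mul, ENNReal.coe_mul]
  calc _ ≤ ∑' n : ℤ, ENNReal.ofReal (48 * 256 ^ (2 * k)) * (C * ENNReal.ofReal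
        (bracket ((n : ℝ) ^ 3 + 1 * n ^ 2 + (2 * m) * n + ((m : ℝ) ^ 2 + σ))
          ^ (-(1 - 5 * δ)))) := by
        refine ENNReal.tsum_le_tsum fun n => ?_
        have e : ∀ τ : ℝ, ENNReal.ofReal (kernelSnd k s δ (n, τ) ((m, σ) + (n, τ))) ^ 2 =
            ENNReal.ofReal (weight k s n (m + n) ^ 2) *
            ENNReal.ofReal (bracket (τ + -(n : ℝ) ^ 3) ^ (-(2 * (1 / 2 - δ))) *
              bracket (τ + (σ + ((m : ℝ) + n) ^ 2)) ^ (-(2 * (1 / 2 - δ)))) := fun τ => by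
          have hm1 : modS ((m, σ) + (n, τ)) = bracket (τ + (σ + ((m : ℝ) + n) ^ 2)) := by
            simp only [modS, Prod.mk_add_mk]; push_cast; congr 1; ring
          rw [← ENNReal.ofReal_mul (sq_nonneg _), ← ENNReal.ofReal_pow, kernelSnd, hm1,
            sq_mul_rpow_neg_mul_rpow_neg _ (modK_pos _).le (bracket_pos _).le]
          · rfl
          · have := weight_nonneg k s n (m + n); have := modK_pos (n, τ)
            have := modS_pos ((m, σ) + (n, τ))
            unfold kernelSnd; positivity
        simp only [e]
        rw [lintegral_const_mul' _ _ ENNReal.ofReal_ne_top]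
        refine mul_le_mul' (ENNReal.ofReal_le_ofReal (weight_sq_le_const hk h₁ h₂ n (m + n)))
          ((hC _ _).trans (le_of_eq ?_))
        rw [← bracket_neg]
        congr 4; ring
    _ ≤ _ := by
        rw [ENNReal.tsum_mul_left, ENNReal.tsum_mul_left]
        exact mul_le_mul' le_rfl (mul_le_mul' le_rfl (hD _ _ _))

/-- Both time frequencies can be integrated, and the decay in the resonance function makes the sum
over the frequency of the first factor finite. -/
theorem exists_lintegral_kernelOutL1_le (hk : 0 < k) (h₁ : 1 + s ≤ 4 * k)
    (h₂ : -(1 / 2) ≤ k - s) (hδ : 0 < δ) (hδκ : 16 * δ ≤ min 1 (2 * k)) :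
    ∃ A : ℝ≥0, ∀ n : ℤ, ∫⁻ τ : ℝ,
      ∫⁻ x, ENNReal.ofReal (kernelOutL1 k s δ (n, τ) x) ^ 2 ∂freqMeasure ≤ A := by
  have hδ1 : 16 * δ ≤ 1 := hδκ.trans (min_le_left _ _)
  set I := ∫⁻ x : ℝ, ENNReal.ofReal (bracket x ^ (-(2 * (1 / 2 + δ)))) with hI
  have hIfin : I < ∞ := lintegral_bracket_rpow_lt_top (by linarith)
  obtain ⟨D, hD⟩ := exists_tsum_weight_sq_mul_le (γ := 1 - 8 * δ) hk h₁ h₂ (by linarith)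
    (by linarith)
  refine ⟨D * (I * I).toNNReal, fun n => ?_⟩
  rw [ENNReal.coe_mul, ENNReal.coe_toNNReal (ENNReal.mul_lt_top hIfin hIfin).ne]
  have hm : Measurable fun p : ℝ × (ℤ × ℝ) =>
      ENNReal.ofReal (kernelOutL1 k s δ (n, p.1) p.2) ^ 2 :=
    ((measurable_kernelOutL1 k s δ).comp
      ((measurable_const.prodMk measurable_fst).prodMk measurable_snd)).ennreal_ofReal.pow_const 2
  rw [lintegral_lintegral_swap hm.aemeasurable, lintegral_freqMeasure hm.lintegral_prod_left']
  rcases eq_or_ne n 0 with rfl | hn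
  · simp [kernelOutL1, weight_zero_left]
  have hshift : ∀ c : ℝ, ∫⁻ x : ℝ, ENNReal.ofReal (bracket (x + c) ^ (-(2 * (1 / 2 + δ)))) = I :=
    fun c => lintegral_add_right_eq_self
      (fun x : ℝ => ENNReal.ofReal (bracket x ^ (-(2 * (1 / 2 + δ))))) c
  calc _ ≤ ∑' m : ℤ, ENNReal.ofReal (weight k s n m ^ 2 *
        bracket (1 * m + ((n : ℝ) ^ 2 - n) / 2) ^ (-(1 - 8 * δ))) * (I * I) := by
        refine ENNReal.tsum_le_tsum fun m => ?_
        set w := weight k s n m * bracket (resonance n m) ^ (-(1 / 2 - 4 * δ)) with hw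
        have hw0 : 0 ≤ w := mul_nonneg (weight_nonneg _ _ _ _) (bracket_rpow_pos _ _).le
        have e : ∀ σ τ : ℝ, ENNReal.ofReal (kernelOutL1 k s δ (n, τ) (m, σ)) ^ 2 =
            ENNReal.ofReal (w ^ 2) *
            (ENNReal.ofReal (bracket (σ + (m : ℝ) ^ 2) ^ (-(2 * (1 / 2 + δ)))) *
              ENNReal.ofReal (bracket (τ + (-σ - ((m : ℝ) - n) ^ 2)) ^ (-(2 * (1 / 2 + δ))))) :=
            fun σ τ => by
          have hm1 : modS ((m, σ) - (n, τ)) = bracket (τ + (-σ - ((m : ℝ) - n) ^ 2)) := by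
            rw [← bracket_neg]
            simp only [modS, Prod.mk_sub_mk]; push_cast; congr 1; ring
          rw [← ENNReal.ofReal_mul (bracket_rpow_pos _ _).le, ← ENNReal.ofReal_mul (sq_nonneg _),
            ← ENNReal.ofReal_pow, kernelOutL1, hm1,
            sq_mul_rpow_neg_mul_rpow_neg _ (modS_pos _).le (bracket_pos _).le]
          · rfl
          · have := weight_nonneg k s n m; have := modS_pos (m, σ)
            have := modS_pos ((m, σ) - (n, τ))
            have := bracket_pos (resonance n m)
            unfold kernelOutL1; positivity
        have hw2 : w ^ 2 ≤ weight k s n m ^ 2 *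
            bracket (1 * m + ((n : ℝ) ^ 2 - n) / 2) ^ (-(1 - 8 * δ)) := by
          rw [hw, mul_pow, one_mul]
          refine mul_le_mul_of_nonneg_left ?_ (sq_nonneg _)
          rw [← Real.rpow_natCast, ← Real.rpow_mul (bracket_pos _).le,
            show -(1 / 2 - 4 * δ) * ((2 : ℕ) : ℝ) = -(1 - 8 * δ) by push_cast; ring]
          exact Real.rpow_le_rpow_of_nonpos (bracket_pos _) (bracket_le_bracket_resonance hn m)
            (by linarith)
        simp only [e]
        have hin : ∀ σ : ℝ, ∫⁻ τ : ℝ, ENNReal.ofReal (w ^ 2) *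
            (ENNReal.ofReal (bracket (σ + (m : ℝ) ^ 2) ^ (-(2 * (1 / 2 + δ)))) *
              ENNReal.ofReal (bracket (τ + (-σ - ((m : ℝ) - n) ^ 2)) ^ (-(2 * (1 / 2 + δ))))) =
            ENNReal.ofReal (w ^ 2) * I *
              ENNReal.ofReal (bracket (σ + (m : ℝ) ^ 2) ^ (-(2 * (1 / 2 + δ)))) := fun σ => by
          rw [lintegral_const_mul' _ _ ENNReal.ofReal_ne_top,
            lintegral_const_mul' _ _ ENNReal.ofReal_ne_top, hshift]
          ring
        simp only [hin]
        rw [lintegral_const_mul' _ _ (ENNReal.mul_lt_top ENNReal.ofReal_lt_top hIfin).ne, hshift,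
          mul_assoc]
        exact mul_le_mul' (ENNReal.ofReal_le_ofReal hw2) le_rfl
    _ ≤ _ := by
        rw [ENNReal.tsum_mul_right]
        exact mul_le_mul' (hD n _ 1 (by simp)) le_rfl

end KernelBounds

/-! ### The bilinear estimate -/

theorem measurable_fourierL2 (u : L2) :
    Measurable fun x : ℤ × ℝ => fourierL2 u x.1 x.2 := by
  refine measurable_from_prod_countable_right fun n => ?_
  have h := (Lp.stronglyMeasurable
    (𝓕 ((memLp_xCoeff u n).toLp (xCoeff u n)) : Lp ℂ 2 (volume : Measure ℝ))).measurable
  exact (h.comp (measurable_id.div_const (2 * Real.pi))).const_mul _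

/-- The modulus of the Fourier transform of `u`, multiplied by the weight of `X^{k,b}`. -/
def weightedFourier (k b : ℝ) (u : L2) (x : ℤ × ℝ) : ℝ≥0∞ :=
  ENNReal.ofReal (bracket x.1 ^ k * modS x ^ b) * ‖fourierL2 u x.1 x.2‖ₑ

theorem measurable_weightedFourier (k b : ℝ) (u : L2) : Measurable (weightedFourier k b u) := by
  refine Measurable.mul (Measurable.ennreal_ofReal ?_) (measurable_fourierL2 u).enorm
  exact ((measurable_of_countable fun n : ℤ => bracket (n : ℝ) ^ k).comp measurable_fst).mul
    (measurable_modS.pow_const b)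

theorem rpow_two_mul {x : ℝ} (hx : 0 ≤ x) (a : ℝ) : x ^ (2 * a) = (x ^ a) ^ 2 := by
  rw [mul_comm, Real.rpow_mul hx, Real.rpow_two]

theorem lintegral_weightedFourier_sq (k b : ℝ) (u : L2) :
    ∫⁻ x, weightedFourier k b u x ^ 2 ∂freqMeasure = normX k b (fourierL2 u) ^ 2 := by
  rw [normX_sq, lintegral_freqMeasure ((measurable_weightedFourier k b u).pow_const 2)]
  congr! 4 with n τ
  have h1 := bracket_rpow_pos (n : ℝ) k
  have h2 := bracket_rpow_pos (τ + (n : ℝ) ^ 2) b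
  rw [weightedFourier, mul_pow, ← ENNReal.ofReal_pow (by unfold modS; positivity),
    rpow_two_mul (bracket_pos _).le, rpow_two_mul (bracket_pos _).le, mul_pow]
  rfl

theorem enorm_fourierDx_mulConj_le (u₁ u₂ : L2) (y : ℤ × ℝ) :
    ‖fourierDx (mulConj u₁ u₂) y.1 y.2‖ₑ ≤ ENNReal.ofReal |(y.1 : ℝ)| *
      ∫⁻ x, ‖fourierL2 u₁ x.1 x.2‖ₑ * ‖fourierL2 u₂ (x - y).1 (x - y).2‖ₑ ∂freqMeasure := by
  obtain ⟨n, τ⟩ := y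
  have hm : Measurable fun x : ℤ × ℝ =>
      ‖fourierL2 u₁ x.1 x.2‖ₑ * ‖fourierL2 u₂ (x - (n, τ)).1 (x - (n, τ)).2‖ₑ :=
    (measurable_fourierL2 u₁).enorm.mul
      ((measurable_fourierL2 u₂).comp (measurable_id.sub_const (n, τ))).enorm
  have hc : ‖(2 * Real.pi : ℂ)⁻¹‖ₑ ≤ 1 := by
    rw [← ofReal_norm, ← ENNReal.ofReal_one]
    refine ENNReal.ofReal_le_ofReal ?_
    rw [norm_inv]
    refine inv_le_one_of_one_le₀ ?_
    have : ‖(2 * Real.pi : ℂ)‖ = 2 * Real.pi := by simp [abs_of_pos Real.pi_pos]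
    rw [this]
    linarith [Real.pi_gt_three]
  have hn : ‖(Complex.I * n : ℂ)‖ₑ = ENNReal.ofReal |(n : ℝ)| := by
    rw [← ofReal_norm, norm_mul, Complex.norm_I, one_mul, Complex.norm_intCast]
  rw [lintegral_freqMeasure hm, fourierDx, enorm_mul, hn, fourierL1_mulConj, enorm_mul]
  gcongr
  refine (mul_le_mul' hc (enorm_tsum_le_tsum_enorm)).trans ?_
  rw [one_mul]
  refine ENNReal.tsum_le_tsum fun m => (enorm_integral_le_lintegral_enorm _).trans (le_of_eq ?_)
  refine lintegral_congr fun σ => ?_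
  rw [enorm_mul, RCLike.enorm_conj]
  rfl

section Pointwise

variable {k s δ : ℝ}

/-- The pointwise bound of the `Y^{s,-1/2}` multiplier by the three kernels times the weights of the
two input norms. -/
theorem multiplierY_le (hδ : 0 ≤ δ) (y x : ℤ × ℝ) :
    |(y.1 : ℝ)| * bracket y.1 ^ s * modK y ^ (-(1 / 2) : ℝ) ≤
      kernelOut k s δ y x * ((bracket x.1 ^ k * modS x ^ (1 / 2 : ℝ)) *
        (bracket (x - y).1 ^ k * modS (x - y) ^ (1 / 2 - δ))) +
      kernelFst k s δ y x * ((bracket x.1 ^ k * modS x ^ (1 / 2 : ℝ)) *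
        (bracket (x - y).1 ^ k * modS (x - y) ^ (1 / 2 - δ))) +
      kernelSnd k s δ y x * ((bracket x.1 ^ k * modS x ^ (1 / 2 - δ)) *
        (bracket (x - y).1 ^ k * modS (x - y) ^ (1 / 2 : ℝ))) := by
  have h := rpow_modulation_le hδ (one_le_bracket (resonance y.1 x.1)) (one_le_modK y)
    (one_le_modS x) (one_le_modS (x - y)) (bracket_resonance_le y x)
  have hw := weight_nonneg k s y.1 x.1
  have hp := bracket_rpow_pos (x.1 : ℝ) k
  have hq := bracket_rpow_pos ((x.1 : ℝ) - y.1) k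
  have e : (((x - y).1 : ℤ) : ℝ) = (x.1 : ℝ) - y.1 := by simp
  have h1 := modS_pos x
  have h2 := modS_pos (x - y)
  have e1 : modS x ^ (-(1 / 2 - δ)) * modS x ^ (1 / 2 : ℝ) = modS x ^ δ := by
    rw [← Real.rpow_add h1]; congr 1; ring
  have e2 : modS x ^ (-(1 / 2 - δ)) * modS x ^ (1 / 2 - δ) = 1 := by
    rw [← Real.rpow_add h1, neg_add_cancel, Real.rpow_zero]
  have e3 : modS (x - y) ^ (-(1 / 2 - δ)) * modS (x - y) ^ (1 / 2 - δ) = 1 := by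
    rw [← Real.rpow_add h2, neg_add_cancel, Real.rpow_zero]
  rw [abs_mul_bracket_rpow_eq k s y.1 x.1, e, kernelOut, kernelFst, kernelSnd]
  calc _ = weight k s y.1 x.1 * (bracket x.1 ^ k * bracket ((x.1 : ℝ) - y.1) ^ k) *
        (modK y ^ (-(1 / 2) : ℝ) * bracket (resonance y.1 x.1) ^ (1 / 2 : ℝ)) := by ring
    _ ≤ weight k s y.1 x.1 * (bracket x.1 ^ k * bracket ((x.1 : ℝ) - y.1) ^ k) *
        (modS x ^ δ + modS x ^ (1 / 2 : ℝ) * modK y ^ (-(1 / 2 - δ)) +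
          modS (x - y) ^ (1 / 2 : ℝ) * modK y ^ (-(1 / 2 - δ))) := by gcongr
    _ = weight k s y.1 x.1 * (bracket x.1 ^ k * bracket ((x.1 : ℝ) - y.1) ^ k) *
        ((modS x ^ (-(1 / 2 - δ)) * modS x ^ (1 / 2 : ℝ)) *
            (modS (x - y) ^ (-(1 / 2 - δ)) * modS (x - y) ^ (1 / 2 - δ)) +
          modS x ^ (1 / 2 : ℝ) * modK y ^ (-(1 / 2 - δ)) *
            (modS (x - y) ^ (-(1 / 2 - δ)) * modS (x - y) ^ (1 / 2 - δ)) +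
          modS (x - y) ^ (1 / 2 : ℝ) * modK y ^ (-(1 / 2 - δ)) *
            (modS x ^ (-(1 / 2 - δ)) * modS x ^ (1 / 2 - δ))) := by
        rw [e1, e2, e3, mul_one, mul_one, mul_one]
    _ = _ := by ring

/-- The pointwise bound of the multiplier of the `L¹` part of `W^s`. -/
theorem multiplierL1_le (hδ : 0 ≤ δ) (hδ' : δ ≤ 1 / 4) (y x : ℤ × ℝ) :
    |(y.1 : ℝ)| * (bracket y.1 ^ s / modK y) ≤
      3 * (kernelOutL1 k s δ y x * ((bracket x.1 ^ k * modS x ^ (1 / 2 : ℝ)) *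
        (bracket (x - y).1 ^ k * modS (x - y) ^ (1 / 2 - δ))) +
      modK y ^ (-(1 / 2 + δ)) * (kernelFst k s δ y x * ((bracket x.1 ^ k * modS x ^ (1 / 2 : ℝ)) *
        (bracket (x - y).1 ^ k * modS (x - y) ^ (1 / 2 - δ)))) +
      modK y ^ (-(1 / 2 + δ)) * (kernelSnd k s δ y x * ((bracket x.1 ^ k * modS x ^ (1 / 2 - δ)) *
        (bracket (x - y).1 ^ k * modS (x - y) ^ (1 / 2 : ℝ))))) := by
  have h := inv_modulation_le hδ hδ' (one_le_bracket (resonance y.1 x.1)) (one_le_modK y)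
    (one_le_modS x) (one_le_modS (x - y)) (bracket_resonance_le y x)
  have hw := weight_nonneg k s y.1 x.1
  have hp := bracket_rpow_pos (x.1 : ℝ) k
  have hq := bracket_rpow_pos ((x.1 : ℝ) - y.1) k
  have e : (((x - y).1 : ℤ) : ℝ) = (x.1 : ℝ) - y.1 := by simp
  have h1 := modS_pos x
  have h2 := modS_pos (x - y)
  have h3 := modK_pos y
  have h4 := bracket_rpow_pos (resonance y.1 x.1) (-(1 / 2 - 4 * δ))
  have e1 : modS x ^ (-(2 * δ)) ≤ modS x ^ (-(1 / 2 + δ)) * modS x ^ (1 / 2 : ℝ) := by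
    rw [← Real.rpow_add h1]
    exact Real.rpow_le_rpow_of_exponent_le (one_le_modS x) (by linarith)
  have e2 : modS x ^ (-(1 / 2 - δ)) * modS x ^ (1 / 2 - δ) = 1 := by
    rw [← Real.rpow_add h1, neg_add_cancel, Real.rpow_zero]
  have e3 : modS (x - y) ^ (-(1 / 2 - δ)) * modS (x - y) ^ (1 / 2 - δ) = 1 := by
    rw [← Real.rpow_add h2, neg_add_cancel, Real.rpow_zero]
  have e4 : modS (x - y) ^ (-(2 * δ)) =
      modS (x - y) ^ (-(1 / 2 + δ)) * modS (x - y) ^ (1 / 2 - δ) := by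
    rw [← Real.rpow_add h2]; congr 1; ring
  have e5 : (modK y)⁻¹ = modK y ^ (-(1 / 2 + δ)) * modK y ^ (-(1 / 2 - δ)) := by
    rw [← Real.rpow_add h3, ← Real.rpow_neg_one]; congr 1; ring
  rw [div_eq_mul_inv, ← mul_assoc, abs_mul_bracket_rpow_eq k s y.1 x.1, e, kernelOutL1, kernelFst,
    kernelSnd]
  calc _ = weight k s y.1 x.1 * (bracket x.1 ^ k * bracket ((x.1 : ℝ) - y.1) ^ k) *
        ((modK y)⁻¹ * bracket (resonance y.1 x.1) ^ (1 / 2 : ℝ)) := by ring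
    _ ≤ weight k s y.1 x.1 * (bracket x.1 ^ k * bracket ((x.1 : ℝ) - y.1) ^ k) *
        (3 * (bracket (resonance y.1 x.1) ^ (-(1 / 2 - 4 * δ)) *
            (modS x ^ (-(1 / 2 + δ)) * modS x ^ (1 / 2 : ℝ)) * modS (x - y) ^ (-(2 * δ)) +
          modS x ^ (1 / 2 : ℝ) * (modK y)⁻¹ + modS (x - y) ^ (1 / 2 : ℝ) * (modK y)⁻¹)) := by
        refine mul_le_mul_of_nonneg_left (h.trans ?_) (by positivity)
        gcongr
    _ = weight k s y.1 x.1 * (bracket x.1 ^ k * bracket ((x.1 : ℝ) - y.1) ^ k) *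
        (3 * (bracket (resonance y.1 x.1) ^ (-(1 / 2 - 4 * δ)) *
            (modS x ^ (-(1 / 2 + δ)) * modS x ^ (1 / 2 : ℝ)) *
              (modS (x - y) ^ (-(1 / 2 + δ)) * modS (x - y) ^ (1 / 2 - δ)) +
          modS x ^ (1 / 2 : ℝ) * (modK y ^ (-(1 / 2 + δ)) * modK y ^ (-(1 / 2 - δ))) *
            (modS (x - y) ^ (-(1 / 2 - δ)) * modS (x - y) ^ (1 / 2 - δ)) +
          modS (x - y) ^ (1 / 2 : ℝ) * (modK y ^ (-(1 / 2 + δ)) * modK y ^ (-(1 / 2 - δ))) *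
            (modS x ^ (-(1 / 2 - δ)) * modS x ^ (1 / 2 - δ)))) := by
        rw [e2, e3, ← e4, ← e5, mul_one, mul_one]
    _ = _ := by ring

end Pointwise

/-- The correlation of the weighted Fourier transforms of two functions against a kernel. -/
def correlation (K : ℤ × ℝ → ℤ × ℝ → ℝ) (f g : ℤ × ℝ → ℝ≥0∞) (y : ℤ × ℝ) : ℝ≥0∞ :=
  ∫⁻ x, ENNReal.ofReal (K y x) * (f x * g (x - y)) ∂freqMeasure

theorem measurable_correlation_integrand {K : ℤ × ℝ → ℤ × ℝ → ℝ}
    (hK : Measurable (Function.uncurry K)) {f g : ℤ × ℝ → ℝ≥0∞} (hf : Measurable f)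
    (hg : Measurable g) : Measurable fun p : (ℤ × ℝ) × (ℤ × ℝ) =>
      ENNReal.ofReal (K p.1 p.2) * (f p.2 * g (p.2 - p.1)) :=
  hK.ennreal_ofReal.mul ((hf.comp measurable_snd).mul (measurable_comp_sub hg))

theorem measurable_correlation_slice {K : ℤ × ℝ → ℤ × ℝ → ℝ}
    (hK : Measurable (Function.uncurry K)) {f g : ℤ × ℝ → ℝ≥0∞} (hf : Measurable f)
    (hg : Measurable g) (y : ℤ × ℝ) :
    Measurable fun x => ENNReal.ofReal (K y x) * (f x * g (x - y)) :=
  (measurable_correlation_integrand hK hf hg).comp measurable_prodMk_left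

theorem measurable_correlation {K : ℤ × ℝ → ℤ × ℝ → ℝ}
    (hK : Measurable (Function.uncurry K)) {f g : ℤ × ℝ → ℝ≥0∞} (hf : Measurable f)
    (hg : Measurable g) : Measurable (correlation K f g) :=
  (measurable_correlation_integrand hK hf hg).lintegral_prod_right'

theorem kernelOut_nonneg (k s δ : ℝ) (y x : ℤ × ℝ) : 0 ≤ kernelOut k s δ y x := by
  have := weight_nonneg k s y.1 x.1; have := modS_pos x; have := modS_pos (x - y)
  unfold kernelOut; positivity

theorem kernelFst_nonneg (k s δ : ℝ) (y x : ℤ × ℝ) : 0 ≤ kernelFst k s δ y x := by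
  have := weight_nonneg k s y.1 x.1; have := modK_pos y; have := modS_pos (x - y)
  unfold kernelFst; positivity

theorem kernelSnd_nonneg (k s δ : ℝ) (y x : ℤ × ℝ) : 0 ≤ kernelSnd k s δ y x := by
  have := weight_nonneg k s y.1 x.1; have := modK_pos y; have := modS_pos x
  unfold kernelSnd; positivity

theorem kernelOutL1_nonneg (k s δ : ℝ) (y x : ℤ × ℝ) : 0 ≤ kernelOutL1 k s δ y x := by
  have := weight_nonneg k s y.1 x.1; have := modS_pos x; have := modS_pos (x - y)
  have := bracket_pos (resonance y.1 x.1)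
  unfold kernelOutL1; positivity

theorem add_sq_le_nine_mul (a b c : ℝ≥0∞) : (a + b + c) ^ 2 ≤ 9 * (a ^ 2 + b ^ 2 + c ^ 2) := by
  have h : ∀ m : ℝ≥0∞, a ≤ m → b ≤ m → c ≤ m → (a + b + c) ^ 2 ≤ 9 * m ^ 2 := fun m h1 h2 h3 => by
    calc (a + b + c) ^ 2 ≤ (m + m + m) ^ 2 := by gcongr
      _ = _ := by ring
  rcases le_total a b with h1 | h1 <;> rcases le_total b c with h2 | h2 <;>
    rcases le_total a c with h3 | h3
  all_goals first
    | exact (h c h3 h2 le_rfl).trans (mul_le_mul' le_rfl le_add_self)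
    | exact (h b h1 le_rfl h2).trans (mul_le_mul' le_rfl (le_add_self.trans le_self_add))
    | exact (h a le_rfl h1 h3).trans (mul_le_mul' le_rfl (le_self_add.trans le_self_add))
    | exact (h c (h1.trans h2) h2 le_rfl).trans (mul_le_mul' le_rfl le_add_self)
    | exact (h a le_rfl h1 (h2.trans h1)).trans (mul_le_mul' le_rfl (le_self_add.trans le_self_add))

theorem lintegral_add_add {α : Type*} [MeasurableSpace α] {μ : Measure α} {f g : α → ℝ≥0∞}
    (hf : Measurable f) (hg : Measurable g) (h : α → ℝ≥0∞) :
    ∫⁻ x, (f x + g x + h x) ∂μ = ∫⁻ x, f x ∂μ + ∫⁻ x, g x ∂μ + ∫⁻ x, h x ∂μ := by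
  have hfg : Measurable fun x => f x + g x := hf.add hg
  rw [lintegral_add_left hfg, lintegral_add_left hf]

section Assembly

variable {k s δ : ℝ} (u₁ u₂ : L2)

theorem multiplierY_mul_enorm_le (hδ : 0 ≤ δ) (y : ℤ × ℝ) :
    ENNReal.ofReal (bracket y.1 ^ s * modK y ^ (-(1 / 2) : ℝ)) *
        ‖fourierDx (mulConj u₁ u₂) y.1 y.2‖ₑ ≤
      correlation (kernelOut k s δ) (weightedFourier k (1 / 2) u₁)
        (weightedFourier k (1 / 2 - δ) u₂) y +
      correlation (kernelFst k s δ) (weightedFourier k (1 / 2) u₁)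
        (weightedFourier k (1 / 2 - δ) u₂) y +
      correlation (kernelSnd k s δ) (weightedFourier k (1 / 2 - δ) u₁)
        (weightedFourier k (1 / 2) u₂) y := by
  have hm₁ := fun b => measurable_weightedFourier k b u₁
  have hm₂ := fun b => measurable_weightedFourier k b u₂
  have hO := measurable_correlation_slice (measurable_kernelOut k s δ) (hm₁ (1 / 2))
    (hm₂ (1 / 2 - δ)) y
  have hF := measurable_correlation_slice (measurable_kernelFst k s δ) (hm₁ (1 / 2))
    (hm₂ (1 / 2 - δ)) y
  have hp : ∀ (b : ℝ) (x : ℤ × ℝ), 0 ≤ bracket x.1 ^ k * modS x ^ b := fun b x =>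
    (mul_pos (bracket_rpow_pos _ _) (Real.rpow_pos_of_pos (modS_pos x) b)).le
  refine (mul_le_mul' le_rfl (enorm_fourierDx_mulConj_le u₁ u₂ y)).trans ?_
  rw [← mul_assoc, ← ENNReal.ofReal_mul (mul_pos (bracket_rpow_pos _ _)
      (Real.rpow_pos_of_pos (modK_pos y) _)).le,
    ← lintegral_const_mul' _ _ ENNReal.ofReal_ne_top, correlation, correlation, correlation,
    ← lintegral_add_add hO hF]
  refine lintegral_mono fun x => ?_
  have h := ENNReal.ofReal_le_ofReal (multiplierY_le (k := k) (s := s) hδ y x)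
  have hA := mul_nonneg (kernelOut_nonneg k s δ y x)
    (mul_nonneg (hp (1 / 2) x) (hp (1 / 2 - δ) (x - y)))
  have hB := mul_nonneg (kernelFst_nonneg k s δ y x)
    (mul_nonneg (hp (1 / 2) x) (hp (1 / 2 - δ) (x - y)))
  have hC := mul_nonneg (kernelSnd_nonneg k s δ y x)
    (mul_nonneg (hp (1 / 2 - δ) x) (hp (1 / 2) (x - y)))
  rw [ENNReal.ofReal_add (add_nonneg hA hB) hC, ENNReal.ofReal_add hA hB,
    ENNReal.ofReal_mul (kernelOut_nonneg k s δ y x),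
    ENNReal.ofReal_mul (kernelFst_nonneg k s δ y x),
    ENNReal.ofReal_mul (kernelSnd_nonneg k s δ y x), ENNReal.ofReal_mul (hp _ _),
    ENNReal.ofReal_mul (hp _ _)] at h
  rw [show bracket (y.1 : ℝ) ^ s * modK y ^ (-(1 / 2) : ℝ) * |(y.1 : ℝ)| =
    |(y.1 : ℝ)| * bracket y.1 ^ s * modK y ^ (-(1 / 2) : ℝ) by ring]
  refine (mul_le_mul' h le_rfl).trans (le_of_eq ?_)
  simp only [weightedFourier]
  ring

theorem multiplierL1_mul_enorm_le (hδ : 0 ≤ δ) (hδ' : δ ≤ 1 / 4) (y : ℤ × ℝ) :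
    ENNReal.ofReal (bracket y.1 ^ s / modK y) * ‖fourierDx (mulConj u₁ u₂) y.1 y.2‖ₑ ≤
      3 * (correlation (kernelOutL1 k s δ) (weightedFourier k (1 / 2) u₁)
        (weightedFourier k (1 / 2 - δ) u₂) y +
      ENNReal.ofReal (modK y ^ (-(1 / 2 + δ))) * correlation (kernelFst k s δ)
        (weightedFourier k (1 / 2) u₁) (weightedFourier k (1 / 2 - δ) u₂) y +
      ENNReal.ofReal (modK y ^ (-(1 / 2 + δ))) * correlation (kernelSnd k s δ)
        (weightedFourier k (1 / 2 - δ) u₁) (weightedFourier k (1 / 2) u₂) y) := by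
  have hm₁ := fun b => measurable_weightedFourier k b u₁
  have hm₂ := fun b => measurable_weightedFourier k b u₂
  have hO := measurable_correlation_slice (measurable_kernelOutL1 k s δ) (hm₁ (1 / 2))
    (hm₂ (1 / 2 - δ)) y
  have hF := (measurable_correlation_slice (measurable_kernelFst k s δ) (hm₁ (1 / 2))
    (hm₂ (1 / 2 - δ)) y).const_mul (ENNReal.ofReal (modK y ^ (-(1 / 2 + δ))))
  have hp : ∀ (b : ℝ) (x : ℤ × ℝ), 0 ≤ bracket x.1 ^ k * modS x ^ b := fun b x =>
    (mul_pos (bracket_rpow_pos _ _) (Real.rpow_pos_of_pos (modS_pos x) b)).le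
  have hK := (bracket_rpow_pos (y.2 - (y.1 : ℝ) ^ 3) (-(1 / 2 + δ))).le
  change 0 ≤ modK y ^ (-(1 / 2 + δ)) at hK
  refine (mul_le_mul' le_rfl (enorm_fourierDx_mulConj_le u₁ u₂ y)).trans ?_
  rw [← mul_assoc, ← ENNReal.ofReal_mul (div_pos (bracket_rpow_pos _ _) (modK_pos _)).le,
    ← lintegral_const_mul' _ _ ENNReal.ofReal_ne_top, correlation, correlation, correlation,
    ← lintegral_const_mul' _ _ ENNReal.ofReal_ne_top,
    ← lintegral_const_mul' _ _ ENNReal.ofReal_ne_top,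
    ← lintegral_add_add hO hF,
    ← lintegral_const_mul' _ _ ENNReal.ofNat_ne_top]
  refine lintegral_mono fun x => ?_
  have h := ENNReal.ofReal_le_ofReal (multiplierL1_le (k := k) (s := s) hδ hδ' y x)
  have hA := mul_nonneg (kernelOutL1_nonneg k s δ y x)
    (mul_nonneg (hp (1 / 2) x) (hp (1 / 2 - δ) (x - y)))
  have hB := mul_nonneg hK (mul_nonneg (kernelFst_nonneg k s δ y x)
    (mul_nonneg (hp (1 / 2) x) (hp (1 / 2 - δ) (x - y))))
  have hC := mul_nonneg hK (mul_nonneg (kernelSnd_nonneg k s δ y x)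
    (mul_nonneg (hp (1 / 2 - δ) x) (hp (1 / 2) (x - y))))
  rw [ENNReal.ofReal_mul (show (0 : ℝ) ≤ 3 by norm_num), ENNReal.ofReal_add (add_nonneg hA hB) hC,
    ENNReal.ofReal_add hA hB, ENNReal.ofReal_mul hK, ENNReal.ofReal_mul hK,
    ENNReal.ofReal_mul (kernelOutL1_nonneg k s δ y x),
    ENNReal.ofReal_mul (kernelFst_nonneg k s δ y x),
    ENNReal.ofReal_mul (kernelSnd_nonneg k s δ y x), ENNReal.ofReal_mul (hp _ _),
    ENNReal.ofReal_mul (hp _ _), ENNReal.ofReal_ofNat] at h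
  rw [mul_comm (bracket (y.1 : ℝ) ^ s / modK y)]
  refine (mul_le_mul' h le_rfl).trans (le_of_eq ?_)
  simp only [weightedFourier]
  ring

end Assembly

/-- The estimate holds for small losses `δ`. For the `Y^{s,-1/2}` part the three kernels are
estimated by Cauchy–Schwarz. For the `L¹` part, the kernels in which an input modulation dominates
come with a factor `⟨τ - n³⟩^{-1/2-δ}`, square-integrable in `τ`, so that the same `L²` bounds
apply. -/
theorem exists_estimateW {k s δ : ℝ} (hk : 0 < k) (h₁ : 1 + s ≤ 4 * k) (h₂ : -(1 / 2) ≤ k - s)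
    (hδ : 0 < δ) (hδκ : 16 * δ ≤ min 1 (2 * k)) : ∃ C : ℝ≥0, EstimateW k s δ C := by
  have hδ1 : 16 * δ ≤ 1 := hδκ.trans (min_le_left _ _)
  obtain ⟨A₁, hA₁⟩ := exists_lintegral_kernelOut_le hk h₁ h₂ hδ hδκ
  obtain ⟨A₂, hA₂⟩ := exists_lintegral_kernelFst_le hk h₁ h₂ hδ hδ1
  obtain ⟨A₃, hA₃⟩ := exists_lintegral_kernelSnd_le hk h₁ h₂ hδ hδ1
  obtain ⟨A₄, hA₄⟩ := exists_lintegral_kernelOutL1_le hk h₁ h₂ hδ hδκ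
  set I := ∫⁻ x : ℝ, ENNReal.ofReal (bracket x ^ (-(2 * (1 / 2 + δ)))) with hI
  have hIfin : I < ∞ := lintegral_bracket_rpow_lt_top (by linarith)
  obtain ⟨J, hJ⟩ : ∃ J : ℝ≥0, (J : ℝ≥0∞) = I := ⟨I.toNNReal, ENNReal.coe_toNNReal hIfin.ne⟩
  -- `9` is the constant of `add_sq_le_nine_mul`, and `81 = 3² * 9`
  set C₁ : ℝ≥0 := 9 * (A₁ + A₂ + A₃) with hC₁
  set C₂ : ℝ≥0 := 81 * (A₄ + J * A₂ + J * A₃) with hC₂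
  refine ⟨(C₁ + 1) + (C₂ + 1), fun u₁ u₂ => ?_⟩
  set f₁ := weightedFourier k (1 / 2) u₁ with hf₁
  set g₁ := weightedFourier k (1 / 2 - δ) u₁ with hg₁
  set f₂ := weightedFourier k (1 / 2) u₂ with hf₂
  set g₂ := weightedFourier k (1 / 2 - δ) u₂ with hg₂
  have mf₁ : Measurable f₁ := measurable_weightedFourier _ _ _
  have mg₁ : Measurable g₁ := measurable_weightedFourier _ _ _
  have mf₂ : Measurable f₂ := measurable_weightedFourier _ _ _
  have mg₂ : Measurable g₂ := measurable_weightedFourier _ _ _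
  set R := normX k (1 / 2 - δ) (fourierL2 u₁) * normX k (1 / 2) (fourierL2 u₂) +
    normX k (1 / 2) (fourierL2 u₁) * normX k (1 / 2 - δ) (fourierL2 u₂) with hR
  have hX : (∫⁻ x, f₁ x ^ 2 ∂freqMeasure) * ∫⁻ x, g₂ x ^ 2 ∂freqMeasure ≤ R ^ 2 := by
    rw [lintegral_weightedFourier_sq, lintegral_weightedFourier_sq, ← mul_pow]
    exact pow_le_pow_left₀ zero_le le_add_self 2
  have hZ : (∫⁻ x, g₁ x ^ 2 ∂freqMeasure) * ∫⁻ x, f₂ x ^ 2 ∂freqMeasure ≤ R ^ 2 := by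
    rw [lintegral_weightedFourier_sq, lintegral_weightedFourier_sq, ← mul_pow]
    exact pow_le_pow_left₀ zero_le le_self_add 2
  have m₁ := measurable_correlation (measurable_kernelOut k s δ) mf₁ mg₂
  have m₂ := measurable_correlation (measurable_kernelFst k s δ) mf₁ mg₂
  have m₃ := measurable_correlation (measurable_kernelSnd k s δ) mg₁ mf₂
  have m₄ := measurable_correlation (measurable_kernelOutL1 k s δ) mf₁ mg₂
  have b₁ : ∫⁻ y, correlation (kernelOut k s δ) f₁ g₂ y ^ 2 ∂freqMeasure ≤ A₁ * R ^ 2 :=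
    (lintegral_sq_correlation_le (K := fun y x => ENNReal.ofReal (kernelOut k s δ y x)) mf₁ mg₂
      (measurable_kernelOut k s δ).ennreal_ofReal hA₁).trans (mul_le_mul' le_rfl hX)
  have b₂ : ∫⁻ y, correlation (kernelFst k s δ) f₁ g₂ y ^ 2 ∂freqMeasure ≤ A₂ * R ^ 2 :=
    (lintegral_sq_correlation_le_of_fst (K := fun y x => ENNReal.ofReal (kernelFst k s δ y x))
      mf₁ mg₂
      (measurable_kernelFst k s δ).ennreal_ofReal hA₂).trans (mul_le_mul' le_rfl hX)
  have b₃ : ∫⁻ y, correlation (kernelSnd k s δ) g₁ f₂ y ^ 2 ∂freqMeasure ≤ A₃ * R ^ 2 :=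
    (lintegral_sq_correlation_le_of_snd (K := fun y x => ENNReal.ofReal (kernelSnd k s δ y x))
      mg₁ mf₂
      (measurable_kernelSnd k s δ).ennreal_ofReal hA₃).trans (mul_le_mul' le_rfl hZ)
  have b₄ : ∑' n : ℤ, (∫⁻ τ : ℝ, correlation (kernelOutL1 k s δ) f₁ g₂ (n, τ)) ^ 2 ≤ A₄ * R ^ 2 :=
    (tsum_sq_lintegral_correlation_le (K := fun y x => ENNReal.ofReal (kernelOutL1 k s δ y x))
      mf₁ mg₂
      (measurable_kernelOutL1 k s δ).ennreal_ofReal hA₄).trans (mul_le_mul' le_rfl hX)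
  have hsq_le : ∀ (a : ℝ≥0∞) (C : ℝ≥0), a ^ 2 ≤ C * R ^ 2 → a ≤ (C + 1 : ℝ≥0) * R := by
    intro a C h
    have hC : (C : ℝ≥0∞) ≤ ((C + 1 : ℝ≥0) : ℝ≥0∞) ^ 2 := by
      rw [← ENNReal.coe_pow, ENNReal.coe_le_coe]
      nlinarith [C.2, show (0 : ℝ≥0) ≤ C ^ 2 from zero_le]
    refine (ENNReal.pow_right_strictMono two_ne_zero).le_iff_le.1 ?_
    rw [mul_pow]
    exact h.trans (mul_le_mul' hC le_rfl)
  have hY : normY s (-1 / 2) (fourierDx (mulConj u₁ u₂)) ≤ (C₁ + 1 : ℝ≥0) * R := by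
    refine hsq_le _ _ ?_
    calc _ ≤ ∫⁻ y, (correlation (kernelOut k s δ) f₁ g₂ y + correlation (kernelFst k s δ) f₁ g₂ y +
          correlation (kernelSnd k s δ) g₁ f₂ y) ^ 2 ∂freqMeasure := by
          have m : Measurable fun y => (correlation (kernelOut k s δ) f₁ g₂ y +
              correlation (kernelFst k s δ) f₁ g₂ y + correlation (kernelSnd k s δ) g₁ f₂ y) ^ 2 :=
            ((m₁.add m₂).add m₃).pow_const 2
          rw [normY_sq, lintegral_freqMeasure m]
          refine ENNReal.tsum_le_tsum fun n => lintegral_mono fun τ => ?_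
          have h := pow_le_pow_left₀ zero_le
            (multiplierY_mul_enorm_le (k := k) (s := s) u₁ u₂ hδ.le (n, τ)) 2
          refine le_trans (le_of_eq ?_) h
          have p1 := bracket_rpow_pos (n : ℝ) s
          have p2 := bracket_rpow_pos (τ - (n : ℝ) ^ 3) (-(1 / 2) : ℝ)
          rw [mul_pow, ← ENNReal.ofReal_pow (by unfold modK; positivity), mul_pow,
            rpow_two_mul (bracket_pos _).le, rpow_two_mul (bracket_pos _).le, neg_div]
          rfl
      _ ≤ ∫⁻ y, 9 * (correlation (kernelOut k s δ) f₁ g₂ y ^ 2 +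
          correlation (kernelFst k s δ) f₁ g₂ y ^ 2 + correlation (kernelSnd k s δ) g₁ f₂ y ^ 2)
            ∂freqMeasure := lintegral_mono fun y => add_sq_le_nine_mul _ _ _
      _ ≤ 9 * (A₁ * R ^ 2 + A₂ * R ^ 2 + A₃ * R ^ 2) := by
          rw [lintegral_const_mul' _ _ ENNReal.ofNat_ne_top,
            lintegral_add_add (m₁.pow_const 2) (m₂.pow_const 2)]
          gcongr
      _ = C₁ * R ^ 2 := by rw [hC₁]; push_cast; ring
  have hU : ∀ T : ℤ × ℝ → ℝ≥0∞, Measurable T →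
      ∑' n : ℤ, (∫⁻ τ : ℝ, ENNReal.ofReal (modK (n, τ) ^ (-(1 / 2 + δ))) * T (n, τ)) ^ 2 ≤
        J * ∫⁻ y, T y ^ 2 ∂freqMeasure := by
    intro T hT
    rw [lintegral_freqMeasure (hT.pow_const 2), ← ENNReal.tsum_mul_left]
    refine ENNReal.tsum_le_tsum fun n => ?_
    refine (sq_lintegral_mul_le volume
      ((measurable_modK.comp measurable_prodMk_left).pow_const _).ennreal_ofReal.aemeasurable
      (hT.comp measurable_prodMk_left).aemeasurable).trans (mul_le_mul' (le_of_eq ?_) le_rfl)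
    rw [hJ, hI]
    refine Eq.trans (lintegral_congr fun τ => ?_) (lintegral_sub_right_eq_self
      (fun x => ENNReal.ofReal (bracket x ^ (-(2 * (1 / 2 + δ))))) ((n : ℝ) ^ 3))
    rw [Function.comp_apply, modK, ← ENNReal.ofReal_pow (bracket_rpow_pos _ _).le, ← mul_neg,
      rpow_two_mul (bracket_pos _).le]
  have hL1 : (∑' n : ℤ, (∫⁻ τ : ℝ, ENNReal.ofReal (bracket n ^ s / bracket (τ - (n : ℝ) ^ 3)) *
      ‖fourierDx (mulConj u₁ u₂) n τ‖ₑ) ^ 2) ^ (1 / 2 : ℝ) ≤ (C₂ + 1 : ℝ≥0) * R := by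
    refine hsq_le _ _ ?_
    rw [← ENNReal.rpow_natCast, ← ENNReal.rpow_mul]
    norm_num only [ENNReal.rpow_one]
    have mn : ∀ n : ℤ, Measurable fun τ : ℝ => ((n, τ) : ℤ × ℝ) := fun n => measurable_prodMk_left
    have mM : ∀ n : ℤ, Measurable fun τ : ℝ => ENNReal.ofReal (modK (n, τ) ^ (-(1 / 2 + δ))) :=
      fun n => ((measurable_modK.comp (mn n)).pow_const _).ennreal_ofReal
    have m₂' : ∀ n : ℤ, Measurable fun τ : ℝ => ENNReal.ofReal (modK (n, τ) ^ (-(1 / 2 + δ))) *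
        correlation (kernelFst k s δ) f₁ g₂ (n, τ) := fun n => (mM n).mul (m₂.comp (mn n))
    have m₄' : ∀ n : ℤ, Measurable fun τ : ℝ => correlation (kernelOutL1 k s δ) f₁ g₂ (n, τ) :=
      fun n => m₄.comp (mn n)
    calc _ ≤ ∑' n : ℤ, 81 * ((∫⁻ τ : ℝ, correlation (kernelOutL1 k s δ) f₁ g₂ (n, τ)) ^ 2 +
          (∫⁻ τ : ℝ, ENNReal.ofReal (modK (n, τ) ^ (-(1 / 2 + δ))) *
            correlation (kernelFst k s δ) f₁ g₂ (n, τ)) ^ 2 +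
          (∫⁻ τ : ℝ, ENNReal.ofReal (modK (n, τ) ^ (-(1 / 2 + δ))) *
            correlation (kernelSnd k s δ) g₁ f₂ (n, τ)) ^ 2) := by
          refine ENNReal.tsum_le_tsum fun n => ?_
          have h : ∫⁻ τ : ℝ, ENNReal.ofReal (bracket n ^ s / bracket (τ - (n : ℝ) ^ 3)) *
              ‖fourierDx (mulConj u₁ u₂) n τ‖ₑ ≤ _ :=
            lintegral_mono fun τ => multiplierL1_mul_enorm_le (k := k) (s := s) u₁ u₂ hδ.le
              (by linarith) (n, τ)
          rw [lintegral_const_mul' _ _ ENNReal.ofNat_ne_top,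
            lintegral_add_add (m₄' n) (m₂' n)] at h
          refine (pow_le_pow_left₀ zero_le h 2).trans ?_
          rw [mul_pow]
          refine (mul_le_mul' le_rfl (add_sq_le_nine_mul _ _ _)).trans (le_of_eq ?_)
          rw [← mul_assoc, show (3 : ℝ≥0∞) ^ 2 * 9 = 81 by norm_num]
      _ ≤ 81 * (A₄ * R ^ 2 + J * (A₂ * R ^ 2) + J * (A₃ * R ^ 2)) := by
          rw [ENNReal.tsum_mul_left, ENNReal.tsum_add, ENNReal.tsum_add]
          refine mul_le_mul' le_rfl (add_le_add (add_le_add b₄ ?_) ?_)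
          · exact (hU _ m₂).trans (mul_le_mul' le_rfl b₂)
          · exact (hU _ m₃).trans (mul_le_mul' le_rfl b₃)
      _ = C₂ * R ^ 2 := by rw [hC₂]; push_cast; ring
  calc normW s (fourierDx (mulConj u₁ u₂)) ≤ (C₁ + 1 : ℝ≥0) * R + (C₂ + 1 : ℝ≥0) * R :=
        add_le_add hY hL1
    _ = _ := by rw [← add_mul, ← ENNReal.coe_add]

end NLSKdV

end

theorem proposition2 (k s : ℝ) :
    (0 < k → 1 + s ≤ 4 * k → -(1 / 2) ≤ k - s →
      ∃ ε₀ : ℝ, 0 < ε₀ ∧ ∃ C : ℝ≥0, ∀ ε : ℝ, 0 < ε → ε ≤ ε₀ → NLSKdV.EstimateW k s ε C) ∧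
    (4 * k < 1 + s ∨ k - s < -(1 / 2) →
      ∀ ε : ℝ, 0 < ε → ¬ ∃ C : ℝ≥0, NLSKdV.EstimateW k s ε C) ∧
    ((∃ C : ℝ≥0, NLSKdV.EstimateY k s C) → 1 + s ≤ 4 * k ∧ -(1 / 2) ≤ k - s) := by
  refine ⟨fun hk h₁ h₂ => ?_, fun h ε hε ⟨C, hC⟩ => ?_, fun ⟨C, hC⟩ =>
    ⟨hC.one_add_le, hC.neg_half_le⟩⟩
  · -- the estimate is stronger for larger `ε`, so it is enough to prove it for one value
    have hκ : 0 < min 1 (2 * k) := by positivity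
    obtain ⟨C, hC⟩ := NLSKdV.exists_estimateW (δ := min 1 (2 * k) / 16) hk h₁ h₂ (by positivity)
      (by linarith)
    exact ⟨min 1 (2 * k) / 16, by positivity, C, fun ε _ hε => hC.mono hε⟩
  · have hY := hC.estimateY hε
    rcases h with h | h
    · exact absurd hY.one_add_le (not_le.2 h)
    · exact absurd hY.neg_half_le (not_le.2 h)
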